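/- Let $l,n_P,n_A\ge 1$ be integers and let $d_P,d_A\ge 0$ be integers. An instance is a triple of problem features in $\mathbb{R}^{d_P}$, predefined algorithm features in $\mathbb{R}^{d_A}$, and a label $y\in\{-1,1\}$; the model input $x\in\mathbb{R}^{d_P+d_A}$ is the concatenation of the two feature vectors. Let $D$ be a probability distribution on instances, and let the training sample $\mathcal S$ consist of $|\mathcal S|=|\mathcal S_{\mathcal P}|\cdot|\mathcal S_{\mathcal A}|$ instances $(x_i,y_i)$ drawn independently from $D$, where $|\mathcal S_{\mathcal P}|=n_P$ and $|\mathcal S_{\mathcal A}|=n_A$. For given bounds $R_1,\dots,R_l$, let $\mathcal F$ be the class of all real-valued networks with $l$ layers $$\mathbf f(x)=W^{(l)}\phi^{(l-1)}\bigl(W^{(l-1)}\phi^{(l-2)}(\cdots\phi^{(1)}(W^{(1)}x))\bigr)$$ of arbitrary hidden widths, with Frobenius norms $\|W^{(i)}\|_F\le R_i$ and with coordinatewise activation functions $\phi^{(i)}$ that are $1$-Lipschitz and positive-homogeneous. For $\gamma>0$ and $\mathbf f\in\mathcal F$ put $$Error_{\mathcal T}(\mathbf f)=P_{(x,y)\sim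 D}\bigl(y\,\mathbf f(x)<0\bigr),\qquad Error_{\mathcal S}(\mathbf f)=\frac{|\{i: y_i\mathbf f(x_i)<\gamma\}|}{|\mathcal S|},$$ the test error and the empirical error at margin $\gamma$. Put $\Gamma_{\mathbf f}=\prod_{i=1}^l R_i$, $\Gamma_{\mathcal S}=\max_{x_j\in\mathcal S}\|x_j\|^2$ (Euclidean norm), and $$c_1=\sqrt{\log\bigl(\log_2\tfrac4\gamma\bigr)}+\sqrt{\log\tfrac1\delta},$$ where for $\gamma>2$ the first root is read as $0$. There are absolute constants $K_1,K_2>0$ such that the following holds for all such $l,n_P,n_A,d_P,d_A$, $(R_i)$ and $D$ and all $\delta\in(0,1)$. Assume $\Gamma_{\mathbf f}>1$ and that $\sqrt{|\mathcal S_{\mathcal P}|\cdot|\mathcal S_{\mathcal A}|}$ dominates $(\log 2)\,l$, for which $\sqrt{|\mathcal S_{\mathcal P}|\cdot|\mathcal S_{\mathcal A}|}\ge(\log 2)\,l$ suffices. Then with probability at least $1-\delta$ over the sample (that is, the exceptional event has outer probability at most $\delta$): if $\Gamma_{\mathcal S}>1$, then simultaneously for all margins $\gamma>0$ and all $\mathbf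 f\in\mathcal F$, $$Error_{\mathcal T}(\mathbf f)\le Error_{\mathcal S}(\mathbf f)+K_1\,\frac{\Gamma_{\mathbf f}\,\Gamma_{\mathcal S}^{3/4}}{|\mathcal S_{\mathcal P}|^{1/4}|\mathcal S_{\mathcal A}|^{1/4}\,\gamma}+K_2\,\frac{c_1}{\sqrt{|\mathcal S_{\mathcal P}|\cdot|\mathcal S_{\mathcal A}|}}.$$ -/

import Mathlib

open MeasureTheory

noncomputable section

namespace AlgSel

section Frobenius

open scoped Matrix.Norms.Frobenius

/-- The Frobenius norm of a real matrix. -/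
def frobNorm {m n : Type} [Fintype m] [Fintype n] (W : Matrix m n ℝ) : ℝ := ‖W‖

end Frobenius

/-- A 1-Lipschitz, positive-homogeneous scalar activation function. -/
structure IsActivation (φ : ℝ → ℝ) : Prop where
  lipschitz : LipschitzWith 1 φ
  posHomogeneous : ∀ c t : ℝ, 0 ≤ c → φ (c * t) = c * φ t

/-- `Network ι l m` is the type of feed-forward networks with `l` layers, with input coordinates
indexed by `ι` and `m` outputs. The hidden widths are arbitrary. A network is given by its weight
matrices `W⁽¹⁾, …, W⁽ˡ⁾` and its activation functions `φ⁽¹⁾, …, φ⁽ˡ⁻¹⁾`. -/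
inductive Network (ι : Type) : ℕ → ℕ → Type
  | first {m : ℕ} (W : Matrix (Fin m) ι ℝ) : Network ι 1 m
  | layer {l k m : ℕ} (N : Network ι l k) (φ : ℝ → ℝ) (W : Matrix (Fin m) (Fin k) ℝ) :
      Network ι (l + 1) m

namespace Network

variable {ι : Type} [Fintype ι]

/-- The function computed by a network,
`W⁽ˡ⁾ φ⁽ˡ⁻¹⁾(W⁽ˡ⁻¹⁾ φ⁽ˡ⁻²⁾(⋯ φ⁽¹⁾(W⁽¹⁾ x)))`, with the activations applied coordinatewise. -/
def eval : {l m : ℕ} → Network ι l m → EuclideanSpace ℝ ι → Fin m → ℝ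
  | _, _, .first W, x => W.mulVec x.ofLp
  | _, _, .layer N φ W, x => W.mulVec (fun j => φ (N.eval x j))

/-- The weight matrix of layer `i` has Frobenius norm at most `R i` (layers are numbered from 1),
and every activation function is 1-Lipschitz and positive-homogeneous. -/
def Admissible (R : ℕ → ℝ) : {l m : ℕ} → Network ι l m → Prop
  | _, _, .first W => frobNorm W ≤ R 1
  | l + 1, _, .layer N φ W => N.Admissible R ∧ IsActivation φ ∧ frobNorm W ≤ R (l + 1)

end Network

/-- The class of all real-valued admissible networks with `l` layers. -/
def networkClass (ι : Type) [Fintype ι] (l : ℕ) (R : ℕ → ℝ) : Set (EuclideanSpace ℝ ι → ℝ) :=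
  {f | ∃ N : Network ι l 1, N.Admissible R ∧ ∀ x, f x = N.eval x 0}

/-- A labelled instance: problem features, predefined algorithm features, and a label. -/
abbrev LabeledInstance (dP dA : ℕ) : Type :=
  EuclideanSpace ℝ (Fin dP) × EuclideanSpace ℝ (Fin dA) × ℝ

/-- The model input: problem features and algorithm features, concatenated. -/
def input {dP dA : ℕ} (z : LabeledInstance dP dA) : EuclideanSpace ℝ (Fin dP ⊕ Fin dA) :=
  WithLp.toLp 2 (Sum.elim z.1.ofLp z.2.1.ofLp)

/-- The label of an instance. -/
def label {dP dA : ℕ} (z : LabeledInstance dP dA) : ℝ := z.2.2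

/-- The test error `P(y f(x) < 0)` of the selector `f` on a fresh instance drawn from `D`. -/
def testError {dP dA : ℕ} (D : Measure (LabeledInstance dP dA))
    (f : EuclideanSpace ℝ (Fin dP ⊕ Fin dA) → ℝ) : ℝ :=
  D.real {z | label z * f (input z) < 0}

/-- The empirical error at margin `γ`: the fraction of training instances with `y f(x) < γ`. -/
def empiricalError {dP dA nP nA : ℕ} (S : Fin nP × Fin nA → LabeledInstance dP dA) (γ : ℝ)
    (f : EuclideanSpace ℝ (Fin dP ⊕ Fin dA) → ℝ) : ℝ :=
  (Set.ncard {i | label (S i) * f (input (S i)) < γ} : ℝ) / ((nP : ℝ) * (nA : ℝ))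

/-- `Γ_f = ∏_{i=1}^l R_i`. -/
def gammaF (l : ℕ) (R : ℕ → ℝ) : ℝ := ∏ i ∈ Finset.Icc 1 l, R i

/-- `Γ_S = max_{x ∈ S} ‖x‖²`, with the Euclidean norm. -/
def gammaS {dP dA nP nA : ℕ} (S : Fin nP × Fin nA → LabeledInstance dP dA) : ℝ :=
  ⨆ i, ‖input (S i)‖ ^ 2

/-- `c₁ = √(log (log₂ (4 / γ))) + √(log (1 / δ))`. The first root is a real number only for
`γ ≤ 2`; the `max` leaves it unchanged there and makes it zero for `γ > 2`. -/
def c₁ (γ δ : ℝ) : ℝ :=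
  √(Real.log (max 1 (Real.logb 2 (4 / γ)))) + √(Real.log (1 / δ))

end AlgSel

end

/-! The ramp loss at scale `ρ` lies above the indicator of a misclassification and below the
indicator of a small margin. The theorem therefore reduces to bounding, uniformly over networks, how
far the mean ramp loss exceeds its empirical average. All networks are positive-homogeneous, so
inputs may be rescaled to norm at most one. The random quantity `Γ_S` then enters only through the
choice of `ρ`, and the complexity bound needs no information about the data.

The complexity of the class is bounded by peeling layers inside an exponential moment
(`signAvg_exp_networkClass_le`). A 1-Lipschitz positive-homogeneous activation has the form `α t + β
|t|` with `|α| + |β| ≤ 1`, and an outer layer acts as an ℓ¹-bounded combination of normalised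
neurons. A signed sum over a network is thus controlled by signed sums of the neurons `g` below and
of `|g|`, and contraction removes the absolute value. Each peel costs a factor 3. What remains is a
linear class, where the norm of a Rademacher sum in a Hilbert space is sub-Gaussian
(`signAvg_exp_norm_le`). At parameter `1 / (Γ_f n^(1/4))` the depth contributes `l log 3 ≤ 2 √n`,
and the complexity is `O(Γ_f n^(-1/4))`.

Symmetrization (`integral_iSup_le_signAvg`) and bounded differences turn this into a
high-probability bound for one `ρ`. A union bound over `ρ = Γ_f / 2^j` covers all margins. Its cost
is absorbed by enlarging the deviation by `2^j / n^(1/4)`, which has the same order as the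
complexity at that scale. Finally `j` is chosen so that `2^j` is comparable to `Γ_f √Γ_S / γ`. -/

noncomputable section

namespace AlgSel

/-! ### Averages over sign vectors. -/

/-- The average of `F` over all sign vectors `s ∈ {-1, 1}ⁿ`. -/
def signAvg : (n : ℕ) → ((Fin n → ℝ) → ℝ) → ℝ
  | 0, F => F Fin.elim0
  | n + 1, F => (signAvg n (fun s => F (Fin.cons 1 s)) + signAvg n (fun s => F (Fin.cons (-1) s))) / 2

theorem signAvg_mono {n : ℕ} {F G : (Fin n → ℝ) → ℝ} (h : ∀ s, F s ≤ G s) :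
    signAvg n F ≤ signAvg n G := by
  induction n with
  | zero => exact h _
  | succ n ih =>
    have h1 := ih (F := fun s => F (Fin.cons 1 s)) (fun s => h _)
    have h2 := ih (F := fun s => F (Fin.cons (-1) s)) (fun s => h _)
    simp only [signAvg]
    linarith

theorem signAvg_const (n : ℕ) (c : ℝ) : signAvg n (fun _ => c) = c := by
  induction n with
  | zero => rfl
  | succ n ih => simp only [signAvg, ih]; ring

theorem signAvg_add {n : ℕ} (F G : (Fin n → ℝ) → ℝ) :
    signAvg n (fun s => F s + G s) = signAvg n F + signAvg n G := by
  induction n with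
  | zero => rfl
  | succ n ih => simp only [signAvg, ih]; ring

theorem signAvg_const_mul {n : ℕ} (c : ℝ) (F : (Fin n → ℝ) → ℝ) :
    signAvg n (fun s => c * F s) = c * signAvg n F := by
  induction n with
  | zero => rfl
  | succ n ih => simp only [signAvg, ih]; ring

theorem signAvg_comp_neg {n : ℕ} (F : (Fin n → ℝ) → ℝ) :
    signAvg n (fun s => F (-s)) = signAvg n F := by
  induction n with
  | zero => exact congrArg F (Subsingleton.elim _ _)
  | succ n ih =>
    have hc (c : ℝ) (s : Fin n → ℝ) :
        -(Fin.cons c s : Fin (n + 1) → ℝ) = Fin.cons (-c) (-s) := by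
      ext i; refine Fin.cases ?_ (fun j => ?_) i <;> simp
    simp only [signAvg, hc, neg_neg]
    rw [ih (fun s => F (Fin.cons (-1) s)), ih (fun s => F (Fin.cons 1 s))]
    ring

theorem exp_signAvg_le {n : ℕ} (F : (Fin n → ℝ) → ℝ) :
    Real.exp (signAvg n F) ≤ signAvg n (fun s => Real.exp (F s)) := by
  set m := signAvg n F with hm
  -- Jensen's inequality, from the tangent line of `exp` at the mean `m`.
  have h : ∀ s, Real.exp m * (1 - m) + Real.exp m * F s ≤ Real.exp (F s) := fun s => by
    have h1 := Real.add_one_le_exp (F s - m)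
    have h2 : Real.exp (F s) = Real.exp m * Real.exp (F s - m) := by
      rw [← Real.exp_add]; congr 1; ring
    rw [h2]
    nlinarith [Real.exp_pos m]
  have := signAvg_mono h
  rw [signAvg_add, signAvg_const, signAvg_const_mul, ← hm] at this
  linarith

theorem signAvg_integral {Ω : Type*} [MeasurableSpace Ω] {μ : Measure Ω} {n : ℕ}
    (F : Ω → (Fin n → ℝ) → ℝ) (hF : ∀ s, Integrable (fun ω => F ω s) μ) :
    Integrable (fun ω => signAvg n (F ω)) μ ∧
      ∫ ω, signAvg n (F ω) ∂μ = signAvg n (fun s => ∫ ω, F ω s ∂μ) := by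
  induction n with
  | zero => exact ⟨hF _, rfl⟩
  | succ n ih =>
    obtain ⟨i1, e1⟩ := ih (fun ω s => F ω (Fin.cons 1 s)) (fun s => hF _)
    obtain ⟨i2, e2⟩ := ih (fun ω s => F ω (Fin.cons (-1) s)) (fun s => hF _)
    refine ⟨(i1.add i2).div_const 2, ?_⟩
    simp only [signAvg]
    rw [integral_div, integral_add i1 i2, e1, e2]

/-! ### Contraction inequalities for signed suprema. -/

section Contraction

variable {κ : Type*} [Finite κ]

theorem le_iSup_finite (a : κ → ℝ) (k : κ) : a k ≤ ⨆ k, a k :=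
  le_ciSup (Set.finite_range a).bddAbove k

/-- Karamata's inequality for two points: a weakly majorized pair has the smaller sum under an
increasing convex function. -/
theorem exp_add_exp_le {p q p' q' : ℝ} (hs : p + q ≤ p' + q') (hp : p ≤ max p' q')
    (hq : q ≤ max p' q') : Real.exp p + Real.exp q ≤ Real.exp p' + Real.exp q' := by
  wlog h : q' ≤ p' generalizing p' q'
  · have := this (p' := q') (q' := p') (by linarith) (by rwa [max_comm]) (by rwa [max_comm])
      (by linarith)
    linarith
  rw [max_eq_left h] at hp hq
  wlog h' : q ≤ p generalizing p q
  · have := this (p := q) (q := p) (by linarith) hq hp (by linarith)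
    linarith
  rcases le_total q q' with hqq | hqq
  · exact add_le_add (Real.exp_le_exp.2 hp) (Real.exp_le_exp.2 hqq)
  -- `q' ≤ q ≤ p ≤ p'`
  have h1 : Real.exp q - Real.exp q' ≤ Real.exp q * (q - q') := by
    have := Real.add_one_le_exp (q' - q)
    have h2 : Real.exp q' = Real.exp q * Real.exp (q' - q) := by
      rw [← Real.exp_add]; congr 1; ring
    rw [h2]; nlinarith [Real.exp_pos q]
  have h3 : Real.exp p * (p' - p) ≤ Real.exp p' - Real.exp p := by
    have := Real.add_one_le_exp (p' - p)
    have h2 : Real.exp p' = Real.exp p * Real.exp (p' - p) := by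
      rw [← Real.exp_add]; congr 1; ring
    rw [h2]; nlinarith [Real.exp_pos p]
  have h4 : Real.exp q * (q - q') ≤ Real.exp p * (p' - p) :=
    mul_le_mul (Real.exp_le_exp.2 h') (by linarith) (by linarith) (Real.exp_pos p).le
  linarith

/-- Let `k` and `k'` attain the two suprema on the left. The sign of `b k - b k'` decides which of
them is the better competitor for which supremum on the right. -/
theorem iSup_add_iSup_contraction [Nonempty κ] (a b c : κ → ℝ)
    (hc : ∀ k k', |c k - c k'| ≤ |b k - b k'|) :
    (⨆ k, (a k + c k)) + (⨆ k, (a k - c k)) ≤ (⨆ k, (a k + b k)) + (⨆ k, (a k - b k)) := by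
  obtain ⟨k, hk⟩ := exists_eq_ciSup_of_finite (f := fun k => a k + c k)
  obtain ⟨k', hk'⟩ := exists_eq_ciSup_of_finite (f := fun k => a k - c k)
  rw [← hk, ← hk']
  have h1 := le_iSup_finite (fun k => a k + b k) k
  have h2 := le_iSup_finite (fun k => a k - b k) k
  have h3 := le_iSup_finite (fun k => a k + b k) k'
  have h4 := le_iSup_finite (fun k => a k - b k) k'
  have h5 := (le_abs_self _).trans (hc k k')
  rcases le_total 0 (b k - b k') with h | h
  · rw [abs_of_nonneg h] at h5; linarith
  · rw [abs_of_nonpos h] at h5; linarith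

/-- Contraction gives the comparison of sums. Since `|b k|` is `b k` or `-b k`, both suprema on the
left are also below the larger one on the right, so the majorization inequality applies. -/
theorem exp_iSup_contraction_abs [Nonempty κ] {t : ℝ} (ht : 0 ≤ t) (a b : κ → ℝ) :
    Real.exp (t * ⨆ k, (a k + |b k|)) + Real.exp (t * ⨆ k, (a k - |b k|)) ≤
      Real.exp (t * ⨆ k, (a k + b k)) + Real.exp (t * ⨆ k, (a k - b k)) := by
  have hmax : ∀ k, a k + |b k| ≤ max (⨆ k, (a k + b k)) (⨆ k, (a k - b k)) := fun k => by
    rcases abs_cases (b k) with ⟨h, -⟩ | ⟨h, -⟩ <;> rw [h]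
    · exact le_max_of_le_left (le_iSup_finite (fun k => a k + b k) k)
    · exact le_max_of_le_right (le_iSup_finite (fun k => a k - b k) k)
  apply exp_add_exp_le
  · rw [← mul_add, ← mul_add]
    exact mul_le_mul_of_nonneg_left
      (iSup_add_iSup_contraction a b _ fun k k' => abs_abs_sub_abs_le_abs_sub _ _) ht
  · rw [← mul_max_of_nonneg _ _ ht]
    exact mul_le_mul_of_nonneg_left (ciSup_le hmax) ht
  · rw [← mul_max_of_nonneg _ _ ht]
    exact mul_le_mul_of_nonneg_left
      (ciSup_le fun k => le_trans (by linarith [abs_nonneg (b k)]) (hmax k)) ht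

theorem signAvg_exp_contraction_abs {t : ℝ} (ht : 0 ≤ t) {n : ℕ} (a : κ → ℝ)
    (b : κ → Fin n → ℝ) :
    signAvg n (fun s => Real.exp (t * ⨆ k, (a k + ∑ i, s i * |b k i|))) ≤
      signAvg n (fun s => Real.exp (t * ⨆ k, (a k + ∑ i, s i * b k i))) := by
  rcases isEmpty_or_nonempty κ with hκ | hκ
  · simp [Real.iSup_of_isEmpty]
  induction n generalizing a with
  | zero => simp [signAvg]
  | succ n ih =>
    simp only [signAvg, Fin.sum_univ_succ, Fin.cons_zero, Fin.cons_succ, ← add_assoc, one_mul,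
      neg_one_mul]
    -- The offset `a` carries the coordinate not yet treated. The induction hypothesis handles the
    -- others, and coordinate 0 is exchanged afterwards for each fixed sign vector.
    have h1 := ih (fun k => a k + |b k 0|) (fun k i => b k i.succ)
    have h2 := ih (fun k => a k + -|b k 0|) (fun k i => b k i.succ)
    refine (div_le_div_of_nonneg_right (add_le_add h1 h2) two_pos.le).trans ?_
    refine div_le_div_of_nonneg_right ?_ two_pos.le
    rw [← signAvg_add, ← signAvg_add]
    refine signAvg_mono fun s => ?_
    have := exp_iSup_contraction_abs ht (fun k => a k + ∑ i, s i * b k i.succ) (fun k => b k 0)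
    simpa only [sub_eq_add_neg, add_right_comm] using this

theorem signAvg_contraction [Nonempty κ] {n : ℕ} (a : κ → ℝ) (b c : κ → Fin n → ℝ)
    (hc : ∀ k k' i, |c k i - c k' i| ≤ |b k i - b k' i|) :
    signAvg n (fun s => ⨆ k, (a k + ∑ i, s i * c k i)) ≤
      signAvg n (fun s => ⨆ k, (a k + ∑ i, s i * b k i)) := by
  induction n generalizing a with
  | zero => simp [signAvg]
  | succ n ih =>
    simp only [signAvg, Fin.sum_univ_succ, Fin.cons_zero, Fin.cons_succ, ← add_assoc, one_mul,
      neg_one_mul]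
    have h1 := ih (fun k => a k + c k 0) (fun k i => b k i.succ) (fun k i => c k i.succ)
      (fun _ _ _ => hc _ _ _)
    have h2 := ih (fun k => a k + -c k 0) (fun k i => b k i.succ) (fun k i => c k i.succ)
      (fun _ _ _ => hc _ _ _)
    refine (div_le_div_of_nonneg_right (add_le_add h1 h2) two_pos.le).trans ?_
    refine div_le_div_of_nonneg_right ?_ two_pos.le
    rw [← signAvg_add, ← signAvg_add]
    refine signAvg_mono fun s => ?_
    have := iSup_add_iSup_contraction (fun k => a k + ∑ i, s i * b k i.succ) (fun k => b k 0)
      (fun k => c k 0) (fun k k' => hc k k' 0)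
    simpa only [sub_eq_add_neg, add_right_comm] using this

end Contraction

/-! ### Exponential moments of Rademacher sums in a Hilbert space. -/

section Hilbert

variable {E : Type*} [NormedAddCommGroup E] [InnerProductSpace ℝ E]

/-- `cosh √t` is the series of `t^k / (2k)!`, whose terms are convex on `[0, ∞)`. Spreading a pair
symmetrically about `p` therefore increases the sum. -/
theorem cosh_sqrt_add_le {p q r : ℝ} (hq : |q| ≤ r) (hr : r ≤ p) :
    Real.cosh √(p + q) + Real.cosh √(p - q) ≤ Real.cosh √(p + r) + Real.cosh √(p - r) := by
  have key : ∀ t : ℝ, 0 ≤ t → HasSum (fun k : ℕ => t ^ k / ((2 * k).factorial : ℝ))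
      (Real.cosh √t) := fun t ht => by
    have := Real.hasSum_cosh √t
    simpa only [pow_mul, Real.sq_sqrt ht] using this
  have hq' := abs_le.1 hq
  have hr0 : 0 ≤ r := (abs_nonneg q).trans hq
  refine hasSum_le (fun k => ?_) ((key (p + q) (by linarith)).add (key (p - q) (by linarith)))
    ((key (p + r) (by linarith)).add (key (p - r) (by linarith)))
  rw [← add_div, ← add_div]
  refine div_le_div_of_nonneg_right ?_ (by positivity)
  have hconv := convexOn_pow (𝕜 := ℝ) k
  rcases eq_or_lt_of_le hr0 with h0 | h0
  · have : q = 0 := by rw [← h0] at hq; simpa using hq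
    simp [this, ← h0]
  have e1 : p + q = ((r + q) / (2 * r)) • (p + r) + ((r - q) / (2 * r)) • (p - r) := by
    simp only [smul_eq_mul]; field_simp; ring
  have e2 : p - q = ((r - q) / (2 * r)) • (p + r) + ((r + q) / (2 * r)) • (p - r) := by
    simp only [smul_eq_mul]; field_simp; ring
  have n1 : 0 ≤ (r + q) / (2 * r) := div_nonneg (by linarith) (by linarith)
  have n2 : 0 ≤ (r - q) / (2 * r) := div_nonneg (by linarith) (by linarith)
  have s1 : (r + q) / (2 * r) + (r - q) / (2 * r) = 1 := by field_simp; ring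
  have m1 : p + r ∈ Set.Ici (0 : ℝ) := by simp only [Set.mem_Ici]; linarith
  have m2 : p - r ∈ Set.Ici (0 : ℝ) := by simp only [Set.mem_Ici]; linarith
  have c1 := hconv.2 m1 m2 n1 n2 s1
  have c2 := hconv.2 m1 m2 n2 n1 (by linarith)
  rw [← e1] at c1
  rw [← e2] at c2
  simp only [smul_eq_mul] at c1 c2
  have : ((r - q) / (2 * r)) = 1 - (r + q) / (2 * r) := by linarith
  rw [this] at c1 c2
  linarith

/-- By Cauchy–Schwarz the squares of `t‖v ± x‖` are no further apart than for collinear vectors, and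
in that case the addition formulas give equality. -/
theorem cosh_norm_add_cosh_norm_le (t : ℝ) (v x : E) :
    Real.cosh (t * ‖v + x‖) + Real.cosh (t * ‖v - x‖) ≤
      2 * (Real.cosh (t * ‖v‖) * Real.cosh (t * ‖x‖)) := by
  set a := t * ‖v‖
  set b := t * ‖x‖
  have hq : |t ^ 2 * (2 * inner ℝ v x)| ≤ 2 * a * b := by
    rw [abs_mul, abs_mul, abs_of_nonneg (sq_nonneg t), abs_two]
    have := abs_real_inner_le_norm v x
    calc t ^ 2 * (2 * |inner ℝ v x|) ≤ t ^ 2 * (2 * (‖v‖ * ‖x‖)) := by gcongr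
      _ = 2 * a * b := by simp only [a, b]; ring
  have h := cosh_sqrt_add_le (p := a ^ 2 + b ^ 2) hq (by nlinarith [sq_nonneg (a - b)])
  have e1 : a ^ 2 + b ^ 2 + t ^ 2 * (2 * inner ℝ v x) = (t * ‖v + x‖) ^ 2 := by
    rw [mul_pow t ‖v + x‖, norm_add_sq_real]; simp only [a, b]; ring
  have e2 : a ^ 2 + b ^ 2 - t ^ 2 * (2 * inner ℝ v x) = (t * ‖v - x‖) ^ 2 := by
    rw [mul_pow t ‖v - x‖, norm_sub_sq_real]; simp only [a, b]; ring
  have e3 : a ^ 2 + b ^ 2 + 2 * a * b = (a + b) ^ 2 := by ring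
  have e4 : a ^ 2 + b ^ 2 - 2 * a * b = (a - b) ^ 2 := by ring
  rw [e1, e2, e3, e4] at h
  simp only [Real.sqrt_sq_eq_abs, Real.cosh_abs] at h
  rw [Real.cosh_add, Real.cosh_sub] at h
  linarith

theorem signAvg_cosh_norm_le {t : ℝ} (ht : 0 ≤ t) {n : ℕ} (v : E) (x : Fin n → E)
    (hx : ∀ i, ‖x i‖ ≤ 1) :
    signAvg n (fun s => Real.cosh (t * ‖v + ∑ i, s i • x i‖)) ≤
      Real.cosh (t * ‖v‖) * Real.exp (n * (t ^ 2 / 2)) := by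
  induction n generalizing v with
  | zero => simp [signAvg]
  | succ n ih =>
    simp only [signAvg, Fin.sum_univ_succ, Fin.cons_zero, Fin.cons_succ, ← add_assoc, one_smul,
      neg_smul, ← sub_eq_add_neg]
    have h1 := ih (v + x 0) (fun i => x i.succ) (fun i => hx _)
    have h2 := ih (v - x 0) (fun i => x i.succ) (fun i => hx _)
    have h3 := cosh_norm_add_cosh_norm_le t v (x 0)
    have h4 : Real.cosh (t * ‖x 0‖) ≤ Real.exp (t ^ 2 / 2) := by
      refine (Real.cosh_le_exp_half_sq _).trans (Real.exp_le_exp.2 ?_)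
      have : t * ‖x 0‖ ≤ t := mul_le_of_le_one_right ht (hx 0)
      have h0 : 0 ≤ t * ‖x 0‖ := by positivity
      gcongr
    have e : Real.exp ((n + 1 : ℕ) * (t ^ 2 / 2)) =
        Real.exp (t ^ 2 / 2) * Real.exp (n * (t ^ 2 / 2)) := by
      rw [← Real.exp_add]; congr 1; push_cast; ring
    rw [e]
    set X := Real.exp (n * (t ^ 2 / 2))
    have hX : 0 < X := Real.exp_pos _
    calc _ ≤ (Real.cosh (t * ‖v + x 0‖) + Real.cosh (t * ‖v - x 0‖)) / 2 * X := by linarith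
      _ ≤ (Real.cosh (t * ‖v‖) * Real.cosh (t * ‖x 0‖)) * X := by gcongr; linarith
      _ ≤ (Real.cosh (t * ‖v‖) * Real.exp (t ^ 2 / 2)) * X := by
        gcongr
      _ = _ := by ring

theorem signAvg_exp_norm_le {t : ℝ} (ht : 0 ≤ t) {n : ℕ} (x : Fin n → E)
    (hx : ∀ i, ‖x i‖ ≤ 1) :
    signAvg n (fun s => Real.exp (t * ‖∑ i, s i • x i‖)) ≤ 2 * Real.exp (n * (t ^ 2 / 2)) := by
  have h := signAvg_cosh_norm_le ht 0 x hx
  simp only [zero_add, norm_zero, mul_zero, Real.cosh_zero, one_mul] at h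
  refine (signAvg_mono (G := fun s => 2 * Real.cosh (t * ‖∑ i, s i • x i‖)) fun s => ?_).trans ?_
  · rw [Real.cosh_eq]
    linarith [Real.exp_pos (-(t * ‖∑ i, s i • x i‖))]
  · rw [signAvg_const_mul]; linarith

end Hilbert

end AlgSel

end

/-! ### Structure of activations and networks. -/

noncomputable section

namespace AlgSel

/-- Homogeneity determines `φ` from `φ 1` and `φ (-1)`, both of absolute value at most one. The
coefficients are their half-difference and half-sum, so `|α| + |β|` is the larger of the two
absolute values. -/
theorem IsActivation.exists_eq_add_abs {φ : ℝ → ℝ} (hφ : IsActivation φ) :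
    ∃ α β : ℝ, |α| + |β| ≤ 1 ∧ ∀ t, φ t = α * t + β * |t| := by
  have h0 : φ 0 = 0 := by simpa using hφ.posHomogeneous 0 0 le_rfl
  have h1 : |φ 1| ≤ 1 := by simpa [h0, Real.dist_eq] using hφ.lipschitz.dist_le_mul 1 0
  have h2 : |φ (-1)| ≤ 1 := by simpa [h0, Real.dist_eq] using hφ.lipschitz.dist_le_mul (-1) 0
  refine ⟨(φ 1 - φ (-1)) / 2, (φ 1 + φ (-1)) / 2, ?_, fun t => ?_⟩
  · rw [abs_le] at h1 h2
    rcases abs_cases ((φ 1 - φ (-1)) / 2) with ⟨h, -⟩ | ⟨h, -⟩ <;>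
    rcases abs_cases ((φ 1 + φ (-1)) / 2) with ⟨h', -⟩ | ⟨h', -⟩ <;> rw [h, h'] <;> linarith
  · rcases le_total 0 t with ht | ht
    · have := hφ.posHomogeneous t 1 ht
      rw [mul_one] at this
      rw [this, abs_of_nonneg ht]; ring
    · have := hφ.posHomogeneous (-t) (-1) (by linarith)
      rw [neg_mul_neg, mul_one] at this
      rw [this, abs_of_nonpos ht]; ring

theorem frobNorm_sq {m n : Type} [Fintype m] [Fintype n] (W : Matrix m n ℝ) :
    frobNorm W ^ 2 = ∑ i, ∑ j, W i j ^ 2 := by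
  unfold frobNorm
  rw [Matrix.frobenius_norm_def, ← Real.sqrt_eq_rpow, Real.sq_sqrt]
  · simp
  · positivity

theorem frobNorm_nonneg {m n : Type} [Fintype m] [Fintype n] (W : Matrix m n ℝ) :
    0 ≤ frobNorm W := by
  unfold frobNorm
  rw [Matrix.frobenius_norm_def]
  positivity

variable {ι : Type} [Fintype ι] {R : ℕ → ℝ}

theorem Network.Admissible.nonneg {l m : ℕ} {N : Network ι l m} (h : N.Admissible R) :
    ∀ i ∈ Finset.Icc 1 l, 0 ≤ R i := by
  induction N with
  | first W =>
    intro i hi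
    obtain rfl : i = 1 := by simp at hi; omega
    exact (frobNorm_nonneg _).trans h
  | @layer l k m N φ W ih =>
    obtain ⟨h1, -, h3⟩ := h
    intro i hi
    rcases (show i ∈ Finset.Icc 1 l ∨ i = l + 1 by simp at hi ⊢; omega) with hi | rfl
    · exact ih h1 i hi
    · exact (frobNorm_nonneg _).trans h3

/-- Each output of an admissible network is a nonnegative multiple of a real-valued admissible
network, and the factors have Euclidean norm at most one. -/
theorem Network.Admissible.exists_eval_eq_mul {l m : ℕ} {N : Network ι l m}
    (h : N.Admissible R) (hR : 0 < R l) :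
    ∃ (c : Fin m → ℝ) (g : Fin m → EuclideanSpace ℝ ι → ℝ), (∀ j, 0 ≤ c j) ∧
      ∑ j, c j ^ 2 ≤ 1 ∧ (∀ j, g j ∈ networkClass ι l R) ∧ ∀ j x, N.eval x j = c j * g j x := by
  have rows : ∀ {k : Type} [Fintype k] (W : Matrix (Fin m) k ℝ), frobNorm W ≤ R l →
      ∃ (c : Fin m → ℝ) (V : Fin m → Matrix (Fin 1) k ℝ), (∀ j, 0 ≤ c j) ∧
      ∑ j, c j ^ 2 ≤ 1 ∧ (∀ j, frobNorm (V j) ≤ R l) ∧ ∀ j v, W.mulVec v j = c j * (V j).mulVec v 0 := by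
    intro k _ W hW
    have hsq : ∀ j, √(∑ i, W j i ^ 2) ^ 2 = ∑ i, W j i ^ 2 := fun j =>
      Real.sq_sqrt (by positivity)
    -- Each row is rescaled to norm `R l`, its relative length becoming the factor. A zero row gives
    -- the zero matrix, through division by zero.
    refine ⟨fun j => √(∑ i, W j i ^ 2) / R l,
      fun j => Matrix.of fun _ i => W j i / (√(∑ i, W j i ^ 2) / R l), fun j => by positivity,
      ?_, fun j => ?_, fun j v => ?_⟩
    · simp only [div_pow, hsq, ← Finset.sum_div]
      rw [← frobNorm_sq]
      exact div_le_one_of_le₀ (pow_le_pow_left₀ (frobNorm_nonneg _) hW 2) (by positivity)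
    · refine abs_le_of_sq_le_sq' ?_ hR.le |>.2
      rw [frobNorm_sq]
      simp only [Matrix.of_apply, div_pow, hsq, Finset.univ_unique, Finset.sum_singleton,
        ← Finset.sum_div]
      rw [div_div_eq_mul_div, mul_comm, mul_div_assoc]
      exact mul_le_of_le_one_right (by positivity) (div_self_le_one _)
    · simp only [Matrix.mulVec, dotProduct, Matrix.of_apply, Finset.mul_sum]
      refine Finset.sum_congr rfl fun i _ => ?_
      by_cases h0 : √(∑ i, W j i ^ 2) / R l = 0
      · have h1 : ∑ i, W j i ^ 2 = 0 := by
          rcases div_eq_zero_iff.1 h0 with h1 | h1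
          · rw [← hsq, h1]; norm_num
          · exact absurd h1 hR.ne'
        have h2 := (Finset.sum_eq_zero_iff_of_nonneg (fun i _ => sq_nonneg (W j i))).1 h1 i
          (Finset.mem_univ _)
        rw [pow_eq_zero_iff two_ne_zero] at h2
        rw [h2]; simp
      · rw [← mul_assoc, mul_div_cancel₀ _ h0]
  cases N with
  | first W =>
    obtain ⟨c, V, h1, h2, h3, h4⟩ := rows W h
    exact ⟨c, fun j x => (V j).mulVec x.ofLp 0, h1, h2, fun j => ⟨.first (V j), h3 j, fun _ => rfl⟩,
      fun j x => h4 j _⟩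
  | layer N φ W =>
    obtain ⟨c, V, h1, h2, h3, h4⟩ := rows W h.2.2
    exact ⟨c, fun j x => (V j).mulVec (fun i => φ (N.eval x i)) 0, h1, h2,
      fun j => ⟨.layer N φ (V j), ⟨h.1, h.2.1, h3 j⟩, fun _ => rfl⟩, fun j x => h4 j _⟩

theorem exists_inner_of_mem_networkClass_one {f : EuclideanSpace ℝ ι → ℝ}
    (hf : f ∈ networkClass ι 1 R) :
    ∃ w : EuclideanSpace ℝ ι, ‖w‖ ≤ R 1 ∧ ∀ x, f x = inner ℝ w x := by
  obtain ⟨N, hN, h⟩ := hf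
  cases N with
  | first W =>
    refine ⟨WithLp.toLp 2 (W 0), ?_, fun x => ?_⟩
    · refine le_trans (le_of_eq ?_) hN
      rw [EuclideanSpace.norm_eq, ← Real.sqrt_sq (frobNorm_nonneg W), frobNorm_sq]
      simp
    · rw [h]
      simp [Network.eval, Matrix.mulVec, dotProduct, PiLp.inner_apply, mul_comm]
  | layer N φ W => cases N

/-- The factors `c j` of the neurons pass through `φ` by homogeneity and join the last weight row.
Cauchy–Schwarz then converts the two Euclidean bounds into one ℓ¹ bound, so that a supremum over
networks reduces to one over single neurons. -/
theorem exists_sum_of_mem_networkClass_succ {l : ℕ} (hl : 1 ≤ l) (hR : 0 < R l)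
    {f : EuclideanSpace ℝ ι → ℝ} (hf : f ∈ networkClass ι (l + 1) R) :
    ∃ (m : ℕ) (d : Fin m → ℝ) (g : Fin m → EuclideanSpace ℝ ι → ℝ) (α β : ℝ),
      ∑ j, |d j| ≤ R (l + 1) ∧ (∀ j, g j ∈ networkClass ι l R) ∧ |α| + |β| ≤ 1 ∧
      ∀ x, f x = ∑ j, d j * (α * g j x + β * |g j x|) := by
  obtain ⟨N, hN, h⟩ := hf
  cases N with
  | first W => omega
  | @layer _ k _ N φ W =>
    obtain ⟨h1, h2, h3⟩ := hN
    obtain ⟨c, g, hc0, hc, hg, hN⟩ := h1.exists_eval_eq_mul hR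
    obtain ⟨α, β, hαβ, hφ⟩ := h2.exists_eq_add_abs
    refine ⟨k, fun j => W 0 j * c j, g, α, β, ?_, hg, hαβ, fun x => ?_⟩
    · have hcs := Finset.sum_mul_sq_le_sq_mul_sq Finset.univ (fun j => |W 0 j|) c
      have hW : ∑ j, |W 0 j| ^ 2 = frobNorm W ^ 2 := by rw [frobNorm_sq]; simp
      rw [hW] at hcs
      have h0 : 0 ≤ R (l + 1) := (frobNorm_nonneg W).trans h3
      refine abs_le_of_sq_le_sq' ?_ h0 |>.2
      have e : ∀ j, |W 0 j * c j| = |W 0 j| * c j := fun j => by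
        rw [abs_mul, abs_of_nonneg (hc0 j)]
      simp only [e]
      calc _ ≤ frobNorm W ^ 2 * ∑ j, c j ^ 2 := hcs
        _ ≤ frobNorm W ^ 2 * 1 := by gcongr
        _ ≤ R (l + 1) ^ 2 := by
          rw [mul_one]; exact pow_le_pow_left₀ (frobNorm_nonneg _) h3 2
    · rw [h]
      simp only [Network.eval, Matrix.mulVec, dotProduct]
      refine Finset.sum_congr rfl fun j _ => ?_
      rw [hN, h2.posHomogeneous _ _ (hc0 j), hφ]; ring

theorem gammaF_succ (l : ℕ) (R : ℕ → ℝ) : gammaF (l + 1) R = gammaF l R * R (l + 1) := by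
  unfold gammaF
  rw [Finset.prod_Icc_succ_top (by omega)]

theorem gammaF_one (R : ℕ → ℝ) : gammaF 1 R = R 1 := by simp [gammaF]

theorem continuous_of_mem_networkClass {l : ℕ} (hl : 1 ≤ l)
    (hR : ∀ i ∈ Finset.Icc 1 l, 0 < R i) {f : EuclideanSpace ℝ ι → ℝ}
    (hf : f ∈ networkClass ι l R) : Continuous f := by
  induction l, hl using Nat.le_induction generalizing f with
  | base =>
    obtain ⟨w, -, h⟩ := exists_inner_of_mem_networkClass_one hf
    rw [funext h]; fun_prop
  | succ l hl ih =>
    obtain ⟨m, d, g, α, β, -, hg, -, h⟩ :=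
      exists_sum_of_mem_networkClass_succ hl (hR l (by simp; omega)) hf
    have := fun j => ih (fun i hi => hR i (by simp at hi ⊢; omega)) (hg j)
    rw [funext h]; fun_prop

theorem map_smul_of_mem_networkClass {l : ℕ} (hl : 1 ≤ l)
    (hR : ∀ i ∈ Finset.Icc 1 l, 0 < R i) {f : EuclideanSpace ℝ ι → ℝ}
    (hf : f ∈ networkClass ι l R) {c : ℝ} (hc : 0 ≤ c) (x : EuclideanSpace ℝ ι) :
    f (c • x) = c * f x := by
  induction l, hl using Nat.le_induction generalizing f with
  | base =>
    obtain ⟨w, -, h⟩ := exists_inner_of_mem_networkClass_one hf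
    rw [h, h, inner_smul_right]
  | succ l hl ih =>
    obtain ⟨m, d, g, α, β, -, hg, -, h⟩ :=
      exists_sum_of_mem_networkClass_succ hl (hR l (by simp; omega)) hf
    have := fun j => ih (fun i hi => hR i (by simp at hi ⊢; omega)) (hg j)
    rw [h, h, Finset.mul_sum]
    refine Finset.sum_congr rfl fun j _ => ?_
    rw [this, abs_mul, abs_of_nonneg hc]; ring

theorem abs_sum_mul_add_le {m : ℕ} {d : Fin m → ℝ} {r q α β : ℝ} (hq : 0 ≤ q)
    (hd : ∑ j, |d j| ≤ r) (hαβ : |α| + |β| ≤ 1) (a b : Fin m → ℝ) (ha : ∀ j, |a j| ≤ q)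
    (hb : ∀ j, |b j| ≤ q) : |∑ j, d j * (α * a j + β * b j)| ≤ r * q := by
  calc |∑ j, d j * (α * a j + β * b j)| ≤ ∑ j, |d j| * q := by
        refine (Finset.abs_sum_le_sum_abs _ _).trans (Finset.sum_le_sum fun j _ => ?_)
        rw [abs_mul]
        refine mul_le_mul_of_nonneg_left ?_ (abs_nonneg _)
        calc |α * a j + β * b j| ≤ |α| * |a j| + |β| * |b j| := by
              rw [← abs_mul, ← abs_mul]; exact abs_add_le _ _
          _ ≤ |α| * q + |β| * q := by gcongr <;> simp [ha, hb]
          _ = (|α| + |β|) * q := by ring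
          _ ≤ q := mul_le_of_le_one_left hq hαβ
    _ = (∑ j, |d j|) * q := by rw [Finset.sum_mul]
    _ ≤ r * q := mul_le_mul_of_nonneg_right hd hq

theorem abs_le_of_mem_networkClass {l : ℕ} (hl : 1 ≤ l)
    (hR : ∀ i ∈ Finset.Icc 1 l, 0 < R i) {f : EuclideanSpace ℝ ι → ℝ}
    (hf : f ∈ networkClass ι l R) (x : EuclideanSpace ℝ ι) : |f x| ≤ gammaF l R * ‖x‖ := by
  induction l, hl using Nat.le_induction generalizing f with
  | base =>
    obtain ⟨w, hw, h⟩ := exists_inner_of_mem_networkClass_one hf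
    rw [h, gammaF_one]
    exact (abs_real_inner_le_norm _ _).trans (by gcongr)
  | succ l hl ih =>
    obtain ⟨m, d, g, α, β, hd, hg, hαβ, h⟩ :=
      exists_sum_of_mem_networkClass_succ hl (hR l (by simp; omega)) hf
    have hR' : ∀ i ∈ Finset.Icc 1 l, 0 < R i := fun i hi => hR i (by simp at hi ⊢; omega)
    have := fun j => ih hR' (hg j)
    rw [h, gammaF_succ, mul_comm (gammaF l R), mul_assoc]
    have h0 : 0 ≤ gammaF l R := Finset.prod_nonneg fun i hi => (hR' i hi).le
    exact abs_sum_mul_add_le (by positivity) hd hαβ _ _ this (fun j => by rw [abs_abs]; exact this j)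

/-! ### Rademacher complexity of the network class. -/

/-- Peeling of the layers: the exponential moment of the signed sums of a finite family of
networks is controlled by the exponential moment of the signed sum of the inputs. -/
theorem signAvg_exp_networkClass_le {l : ℕ} (hl : 1 ≤ l)
    (hR : ∀ i ∈ Finset.Icc 1 l, 0 < R i) {n : ℕ} (x : Fin n → EuclideanSpace ℝ ι)
    {κ : Type} [Finite κ] (f : κ → EuclideanSpace ℝ ι → ℝ)
    (hf : ∀ k, f k ∈ networkClass ι l R) {t : ℝ} (ht : 0 ≤ t) :
    signAvg n (fun s => Real.exp (t * ⨆ k, |∑ i, s i * f k (x i)|)) ≤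
      3 ^ l * signAvg n (fun s => Real.exp (t * gammaF l R * ‖∑ i, s i • x i‖)) := by
  induction l, hl using Nat.le_induction generalizing κ t with
  | base =>
    rw [gammaF_one, ← signAvg_const_mul]
    refine signAvg_mono fun s => ?_
    refine le_trans (Real.exp_le_exp.2 ?_) (le_mul_of_one_le_left (Real.exp_pos _).le (by norm_num))
    rw [mul_assoc]
    have hR1 : 0 < R 1 := hR 1 (by simp)
    refine mul_le_mul_of_nonneg_left (Real.iSup_le (fun k => ?_) (by positivity)) ht
    obtain ⟨w, hw, h⟩ := exists_inner_of_mem_networkClass_one (hf k)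
    have : ∑ i, s i * f k (x i) = inner ℝ w (∑ i, s i • x i) := by
      rw [inner_sum]
      exact Finset.sum_congr rfl fun i _ => by rw [h, inner_smul_right]
    rw [this]
    exact (abs_real_inner_le_norm _ _).trans (by gcongr)
  | succ l hl ih =>
    have hR' : ∀ i ∈ Finset.Icc 1 l, 0 < R i := fun i hi => hR i (by simp at hi ⊢; omega)
    have hr : 0 < R (l + 1) := hR (l + 1) (by simp)
    choose m d g α β hd hg hαβ h using fun k =>
      exists_sum_of_mem_networkClass_succ hl (hR' l (by simp; omega)) (hf k)
    -- The neurons of all networks in the family are pooled. The index set stays finite although the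
    -- widths are arbitrary.
    set g' : (Σ k, Fin (m k)) → EuclideanSpace ℝ ι → ℝ := fun p => g p.1 p.2 with hg'
    set U : (Fin n → ℝ) → ℝ := fun s => ⨆ p, |∑ i, s i * g' p (x i)|
    set V : (Fin n → ℝ) → ℝ := fun s => ⨆ p, ∑ i, s i * |g' p (x i)|
    have hU0 : ∀ s, 0 ≤ U s := fun s => Real.iSup_nonneg fun p => abs_nonneg _
    have hVU : signAvg n (fun s => Real.exp (t * R (l + 1) * V s)) ≤
        signAvg n (fun s => Real.exp (t * R (l + 1) * U s)) := by
      have := signAvg_exp_contraction_abs (t := t * R (l + 1)) (by positivity) (fun _ => (0 : ℝ))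
        (fun p i => g' p (x i))
      simp only [zero_add] at this
      refine this.trans (signAvg_mono fun s => Real.exp_le_exp.2 ?_)
      refine mul_le_mul_of_nonneg_left (Real.iSup_le (fun p => ?_) (hU0 s)) (by positivity)
      exact (le_abs_self _).trans (le_iSup_finite (fun p => |∑ i, s i * g' p (x i)|) p)
    -- The absolute signed sum of `|g|` is split into its two one-sided suprema `V s` and `V (-s)`.
    -- Bounding the exponential of a maximum of three by the sum gives the factor 3 of the layer.
    have key : ∀ s : Fin n → ℝ, Real.exp (t * ⨆ k, |∑ i, s i * f k (x i)|) ≤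
        Real.exp (t * R (l + 1) * U s) + (Real.exp (t * R (l + 1) * V s) +
          Real.exp (t * R (l + 1) * V (-s))) := fun s => by
      have hsup : (⨆ k, |∑ i, s i * f k (x i)|) ≤ R (l + 1) * max (U s) (max (V s) (V (-s))) := by
        have hq : 0 ≤ max (U s) (max (V s) (V (-s))) := le_max_of_le_left (hU0 s)
        refine Real.iSup_le (fun k => ?_) (by positivity)
        have e : ∑ i, s i * f k (x i) = ∑ j, d k j * (α k * (∑ i, s i * g k j (x i)) +
            β k * (∑ i, s i * |g k j (x i)|)) := by
          simp only [h, Finset.mul_sum, ← Finset.sum_add_distrib]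
          rw [Finset.sum_comm]
          refine Finset.sum_congr rfl fun j _ => Finset.sum_congr rfl fun i _ => ?_
          ring
        rw [e]
        refine abs_sum_mul_add_le hq (hd k) (hαβ k) _ _ (fun j => ?_) (fun j => ?_)
        · exact le_max_of_le_left (le_iSup_finite (fun p => |∑ i, s i * g' p (x i)|) ⟨k, j⟩)
        · refine le_max_of_le_right (abs_le'.2 ⟨le_max_of_le_left ?_, le_max_of_le_right ?_⟩)
          · exact le_iSup_finite (fun p => ∑ i, s i * |g' p (x i)|) ⟨k, j⟩
          · have : _ ≤ V (-s) := le_iSup_finite (fun p => ∑ i, (-s) i * |g' p (x i)|) ⟨k, j⟩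
            refine le_trans (le_of_eq ?_) this
            simp [hg']
      have h1 := Real.exp_le_exp.2 (mul_le_mul_of_nonneg_left hsup ht)
      rw [← mul_assoc] at h1
      refine h1.trans ?_
      have p1 := Real.exp_pos (t * R (l + 1) * U s)
      have p2 := Real.exp_pos (t * R (l + 1) * V s)
      have p3 := Real.exp_pos (t * R (l + 1) * V (-s))
      rcases max_choice (U s) (max (V s) (V (-s))) with h | h <;> rw [h]
      · linarith
      rcases max_choice (V s) (V (-s)) with h | h <;> rw [h] <;> linarith
    have h2 := signAvg_mono key
    rw [signAvg_add, signAvg_add,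
      signAvg_comp_neg (fun s => Real.exp (t * R (l + 1) * V s))] at h2
    have h3 := ih hR' g' (fun p => hg p.1 p.2) (t := t * R (l + 1)) (by positivity)
    rw [gammaF_succ, pow_succ]
    have e : t * R (l + 1) * gammaF l R = t * (gammaF l R * R (l + 1)) := by ring
    rw [e] at h3
    linarith

theorem signAvg_iSup_networkClass_le {l : ℕ} (hl : 1 ≤ l)
    (hR : ∀ i ∈ Finset.Icc 1 l, 0 < R i) {n : ℕ} (hn : 1 ≤ n) (hnl : Real.log 2 * l ≤ √n)
    (x : Fin n → EuclideanSpace ℝ ι) (hx : ∀ i, ‖x i‖ ≤ 1)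
    {κ : Type} [Finite κ] (f : κ → EuclideanSpace ℝ ι → ℝ)
    (hf : ∀ k, f k ∈ networkClass ι l R) :
    signAvg n (fun s => ⨆ k, ∑ i, s i * f k (x i)) ≤ n * (4 * gammaF l R / (n : ℝ) ^ (1 / 4 : ℝ)) := by
  have hΓ : 0 < gammaF l R := Finset.prod_pos hR
  set q : ℝ := (n : ℝ) ^ (1 / 4 : ℝ) with hq
  have hn0 : (1 : ℝ) ≤ n := by exact_mod_cast hn
  have hq1 : 1 ≤ q := Real.one_le_rpow hn0 (by norm_num)
  have hq2 : q ^ 2 = √n := by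
    rw [hq, ← Real.rpow_natCast, ← Real.rpow_mul (by linarith), Real.sqrt_eq_rpow]; norm_num
  have hq4 : q ^ 4 = n := by
    rw [show q ^ 4 = (q ^ 2) ^ 2 by ring, hq2, Real.sq_sqrt (by linarith)]
  -- With this parameter the logarithms of `3^l`, of `2` and of the sub-Gaussian factor are all `O(q
  -- ^ 2)`, where `q ^ 2 = √n`.
  set t : ℝ := 1 / (gammaF l R * q) with ht
  have ht0 : 0 < t := by positivity
  have htΓ : t * gammaF l R = 1 / q := by rw [ht]; field_simp
  set A := signAvg n (fun s => ⨆ k, |∑ i, s i * f k (x i)|)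
  have h1 : signAvg n (fun s => ⨆ k, ∑ i, s i * f k (x i)) ≤ A := by
    refine signAvg_mono fun s => Real.iSup_le (fun k => (le_abs_self _).trans ?_)
      (Real.iSup_nonneg fun k => abs_nonneg _)
    exact le_iSup_finite (fun k => |∑ i, s i * f k (x i)|) k
  refine h1.trans ?_
  have h2 : Real.exp (t * A) ≤ 3 ^ l * (2 * Real.exp (n * ((1 / q) ^ 2 / 2))) := by
    rw [← signAvg_const_mul]
    refine (exp_signAvg_le _).trans ((signAvg_exp_networkClass_le hl hR x f hf ht0.le).trans ?_)
    rw [htΓ]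
    exact mul_le_mul_of_nonneg_left (signAvg_exp_norm_le (by positivity) x hx) (by positivity)
  have hlog2 : Real.log 2 ≤ 1 := by linarith [Real.log_two_lt_d9]
  have h3 : (3 : ℝ) ^ l * (2 * Real.exp (n * ((1 / q) ^ 2 / 2))) ≤ Real.exp (4 * q ^ 2) := by
    have a1 : (3 : ℝ) ^ l ≤ Real.exp (2 * q ^ 2) := by
      -- Rounding 3 up to 4 expresses the depth cost through `log 2 * l`, which is at most `√n`.
      have : (3 : ℝ) ≤ Real.exp (2 * Real.log 2) := by
        rw [mul_comm, Real.exp_mul, Real.exp_log two_pos]; norm_num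
      calc (3 : ℝ) ^ l ≤ Real.exp (2 * Real.log 2) ^ l := by gcongr
        _ = Real.exp (2 * (Real.log 2 * l)) := by
          rw [← Real.exp_nat_mul]; congr 1; ring
        _ ≤ _ := Real.exp_le_exp.2 (by rw [hq2]; linarith)
    have a2 : (2 : ℝ) ≤ Real.exp (q ^ 2) := by
      have := Real.add_one_le_exp (q ^ 2); nlinarith
    have a3 : Real.exp (n * ((1 / q) ^ 2 / 2)) ≤ Real.exp (q ^ 2) := by
      refine Real.exp_le_exp.2 ?_
      rw [← hq4]; field_simp; norm_num
    calc _ ≤ Real.exp (2 * q ^ 2) * (Real.exp (q ^ 2) * Real.exp (q ^ 2)) := by gcongr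
      _ = _ := by rw [← Real.exp_add, ← Real.exp_add]; congr 1; ring
  have h4 := Real.exp_le_exp.1 (h2.trans h3)
  rw [← hq4]
  have : A ≤ 4 * q ^ 2 / t := by rw [le_div_iff₀ ht0]; linarith
  refine this.trans (le_of_eq ?_)
  rw [ht]; field_simp

end AlgSel

end

/-! ### Bounded differences on product measures. -/

noncomputable section

namespace AlgSel

section Concentration

variable {Z : Type*} [MeasurableSpace Z] {D : Measure Z} [IsProbabilityMeasure D]

theorem measurePreserving_cons (n : ℕ) :
    MeasurePreserving (MeasurableEquiv.piFinSuccAbove (fun _ : Fin (n + 1) => Z) 0).symm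
      (D.prod (Measure.pi fun _ : Fin n => D)) (Measure.pi fun _ : Fin (n + 1) => D) :=
  (measurePreserving_piFinSuccAbove (fun _ : Fin (n + 1) => D) 0).symm

theorem piFinSuccAbove_symm_eq_cons {n : ℕ} (p : Z × (Fin n → Z)) :
    (MeasurableEquiv.piFinSuccAbove (fun _ : Fin (n + 1) => Z) 0).symm p = Fin.cons p.1 p.2 := by
  ext i
  refine Fin.cases ?_ (fun j => ?_) i <;> rfl

theorem measurable_cons (n : ℕ) :
    Measurable (fun p : Z × (Fin n → Z) => (Fin.cons p.1 p.2 : Fin (n + 1) → Z)) := by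
  have := (MeasurableEquiv.piFinSuccAbove (fun _ : Fin (n + 1) => Z) 0).symm.measurable
  rwa [funext piFinSuccAbove_symm_eq_cons] at this

theorem integrable_cons {n : ℕ} {F : (Fin (n + 1) → Z) → ℝ}
    (hF : Integrable F (Measure.pi fun _ => D)) :
    Integrable (fun p : Z × (Fin n → Z) => F (Fin.cons p.1 p.2))
      (D.prod (Measure.pi fun _ => D)) := by
  have := (measurePreserving_cons (D := D) n).integrable_comp_of_integrable hF
  simpa only [Function.comp_def, piFinSuccAbove_symm_eq_cons] using this

theorem integral_pi_succ {n : ℕ} {F : (Fin (n + 1) → Z) → ℝ}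
    (hF : Integrable F (Measure.pi fun _ => D)) :
    ∫ S, F S ∂(Measure.pi fun _ => D) = ∫ z, ∫ y, F (Fin.cons z y) ∂(Measure.pi fun _ => D) ∂D := by
  rw [← (measurePreserving_cons (D := D) n).integral_comp']
  simp only [piFinSuccAbove_symm_eq_cons]
  exact integral_prod _ (integrable_cons hF)

theorem integral_pi_succ' {n : ℕ} {F : (Fin (n + 1) → Z) → ℝ}
    (hF : Integrable F (Measure.pi fun _ => D)) :
    ∫ S, F S ∂(Measure.pi fun _ => D) = ∫ y, ∫ z, F (Fin.cons z y) ∂D ∂(Measure.pi fun _ => D) := by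
  rw [integral_pi_succ hF]
  exact integral_integral_swap (integrable_cons hF)

theorem integrable_of_measurable_of_abs_le {Ω : Type*} [MeasurableSpace Ω] {μ : Measure Ω}
    [IsFiniteMeasure μ] {f : Ω → ℝ} (hf : Measurable f) {M : ℝ} (hM : ∀ ω, |f ω| ≤ M) :
    Integrable f μ :=
  Integrable.of_bound hf.aestronglyMeasurable M (.of_forall hM)

/-- Hoeffding's lemma: `hc` confines `g` to an interval of length `c` starting at its infimum. -/
theorem integral_exp_mul_sub_integral_le {g : Z → ℝ} (hg : Measurable g) {c M : ℝ}
    (hM : ∀ z, |g z| ≤ M) (hc : ∀ z z', g z ≤ g z' + c) (t : ℝ) :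
    ∫ z, Real.exp (t * (g z - ∫ w, g w ∂D)) ∂D ≤ Real.exp (t ^ 2 * c ^ 2 / 8) := by
  have : Nonempty Z := nonempty_of_isProbabilityMeasure D
  have hbdd : BddBelow (Set.range g) := ⟨-M, by rintro _ ⟨z, rfl⟩; exact (abs_le.1 (hM z)).1⟩
  have hmem : ∀ z, g z ∈ Set.Icc (⨅ w, g w) ((⨅ w, g w) + c) := fun z =>
    ⟨ciInf_le hbdd z, by
      have : g z - c ≤ ⨅ w, g w := le_ciInf fun w => by linarith [hc z w]
      linarith⟩
  have h := (ProbabilityTheory.hasSubgaussianMGF_of_mem_Icc (μ := D) hg.aemeasurable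
    (.of_forall hmem)).mgf_le t
  refine h.trans (le_of_eq ?_)
  congr 1
  simp only [add_sub_cancel_left, NNReal.coe_pow, NNReal.coe_div, coe_nnnorm, Real.norm_eq_abs,
    NNReal.coe_ofNat, div_pow, sq_abs]
  ring

/-- The exponential moment bound behind McDiarmid's bounded difference inequality. -/
theorem integral_exp_le_of_bounded_differences {n : ℕ} {F : (Fin n → Z) → ℝ} (hF : Measurable F)
    {c M : ℝ} (hM : ∀ S, |F S| ≤ M)
    (hc : ∀ S i z, F (Function.update S i z) ≤ F S + c) (t : ℝ) :
    ∫ S, Real.exp (t * (F S - ∫ S', F S' ∂(Measure.pi fun _ => D))) ∂(Measure.pi fun _ => D) ≤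
      Real.exp (n * (t ^ 2 * c ^ 2 / 8)) := by
  induction n with
  | zero =>
    have : ∀ S, F S = F default := fun S => congrArg F (Subsingleton.elim _ _)
    simp [this]
  | succ n ih =>
    set m := ∫ S', F S' ∂(Measure.pi fun _ => D) with hm
    -- `G` is the conditional expectation given the first coordinate. It inherits the difference
    -- bound, so Hoeffding's lemma applies to it and the induction hypothesis to the remaining
    -- fluctuation.
    set G : Z → ℝ := fun z => ∫ y, F (Fin.cons z y) ∂(Measure.pi fun _ => D) with hG
    have hFc : Measurable (fun p : Z × (Fin n → Z) => F (Fin.cons p.1 p.2)) :=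
      hF.comp (measurable_cons n)
    have hFz : ∀ z, Measurable (fun y : Fin n → Z => F (Fin.cons z y)) := fun z =>
      hFc.comp measurable_prodMk_left
    have hFi : ∀ z, Integrable (fun y : Fin n → Z => F (Fin.cons z y))
        (Measure.pi fun _ => D) := fun z =>
      integrable_of_measurable_of_abs_le (hFz z) fun y => hM _
    have hmG : m = ∫ z, G z ∂D := integral_pi_succ (integrable_of_measurable_of_abs_le hF hM)
    have hGm : Measurable G := hFc.stronglyMeasurable.integral_prod_right'.measurable
    have hGM : ∀ z, |G z| ≤ M := fun z => by
      have := norm_integral_le_of_norm_le_const (μ := Measure.pi fun _ : Fin n => D)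
        (f := fun y => F (Fin.cons z y)) (.of_forall fun y => hM (Fin.cons z y))
      simpa using this
    have hGc : ∀ z z', G z ≤ G z' + c := fun z z' => by
      have h1 : ∫ y, (F (Fin.cons z' y) + c) ∂(Measure.pi fun _ : Fin n => D) = G z' + c := by
        rw [integral_add (hFi z') (integrable_const _)]; simp [hG]
      rw [← h1]
      refine integral_mono (hFi z) ((hFi z').add (integrable_const _)) fun y => ?_
      have := hc (Fin.cons z' y) 0 z
      rwa [Fin.update_cons_zero] at this
    have hbd : ∀ S, |Real.exp (t * (F S - m))| ≤ Real.exp (|t| * (M + |m|)) := fun S => by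
      rw [Real.abs_exp, Real.exp_le_exp]
      refine (le_abs_self _).trans ?_
      rw [abs_mul]
      gcongr
      exact (abs_sub _ _).trans (by linarith [hM S])
    have hE : Integrable (fun S => Real.exp (t * (F S - m))) (Measure.pi fun _ => D) :=
      integrable_of_measurable_of_abs_le (by fun_prop) hbd
    rw [integral_pi_succ hE]
    set X := Real.exp (n * (t ^ 2 * c ^ 2 / 8)) with hX
    have inner : ∀ z, ∫ y, Real.exp (t * (F (Fin.cons z y) - m)) ∂(Measure.pi fun _ => D) ≤
        Real.exp (t * (G z - m)) * X := fun z => by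
      have h1 := ih (hFz z) (fun S => hM _) (fun S i w => by
        have := hc (Fin.cons z S) i.succ w
        rwa [← Fin.cons_update] at this)
      have h2 : ∀ y : Fin n → Z, Real.exp (t * (F (Fin.cons z y) - m)) =
          Real.exp (t * (G z - m)) * Real.exp (t * (F (Fin.cons z y) - G z)) := fun y => by
        rw [← Real.exp_add]; congr 1; ring
      simp only [h2]
      rw [integral_const_mul]
      exact mul_le_mul_of_nonneg_left h1 (Real.exp_pos _).le
    have hGe : Integrable (fun z => Real.exp (t * (G z - m)) * X) D := by
      refine Integrable.mul_const ?_ _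
      refine integrable_of_measurable_of_abs_le (M := Real.exp (|t| * (M + |m|))) (by fun_prop)
        fun z => ?_
      rw [Real.abs_exp, Real.exp_le_exp]
      refine (le_abs_self _).trans ?_
      rw [abs_mul]
      gcongr
      exact (abs_sub _ _).trans (by linarith [hGM z])
    refine (integral_mono (integrable_cons hE).integral_prod_left hGe inner).trans ?_
    rw [integral_mul_const, hmG]
    have h3 := integral_exp_mul_sub_integral_le (D := D) hGm hGM hGc t
    calc _ ≤ Real.exp (t ^ 2 * c ^ 2 / 8) * X :=
          mul_le_mul_of_nonneg_right h3 (Real.exp_pos _).le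
      _ = _ := by rw [hX, ← Real.exp_add]; congr 1; push_cast; ring

/-! ### Symmetrization and uniform deviation. -/

theorem integrable_iSup_finite {Ω κ : Type*} [MeasurableSpace Ω] {μ : Measure Ω} [Finite κ]
    {f : κ → Ω → ℝ} (hm : ∀ k, Measurable (f k)) (hf : ∀ k, Integrable (f k) μ) :
    Integrable (fun ω => ⨆ k, f k ω) μ := by
  have := Fintype.ofFinite κ
  refine Integrable.mono' (integrable_finsetSum Finset.univ fun k _ => (hf k).abs)
    (Measurable.iSup hm).aestronglyMeasurable (.of_forall fun ω => ?_)
  rcases isEmpty_or_nonempty κ with h | h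
  · simp
  obtain ⟨k, hk⟩ := exists_eq_ciSup_of_finite (f := fun k => f k ω)
  rw [← hk]
  exact Finset.single_le_sum (f := fun k => |f k ω|) (fun _ _ => abs_nonneg _) (Finset.mem_univ k)

variable {κ : Type*} [Finite κ]

/-- Symmetrizes one sample point without a ghost sample: the integrand at `k` is the half-sum of `a
k + 2 ∫ ψ k`, which is at most the mean of the supremum, and `a k - 2 ψ k z`. -/
theorem integral_iSup_symmetrize [Nonempty κ] {ψ : κ → Z → ℝ} (hψ : ∀ k, Measurable (ψ k))
    (hψ1 : ∀ k z, |ψ k z| ≤ 1) (a : κ → ℝ) :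
    ∫ z, (⨆ k, (a k + ((∫ w, ψ k w ∂D) - ψ k z))) ∂D ≤
      ∫ z, ((⨆ k, (a k + 2 * ψ k z)) + ⨆ k, (a k + -(2 * ψ k z))) / 2 ∂D := by
  have hi : ∀ k, Integrable (ψ k) D := fun k => integrable_of_measurable_of_abs_le (hψ k) (hψ1 k)
  have i1 : Integrable (fun z => ⨆ k, (a k + 2 * ψ k z)) D :=
    integrable_iSup_finite (fun k => by have := hψ k; fun_prop) (fun k =>
      (integrable_const _).add ((hi k).const_mul 2))
  have i2 : Integrable (fun z => ⨆ k, (a k + -(2 * ψ k z))) D :=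
    integrable_iSup_finite (fun k => by have := hψ k; fun_prop) (fun k =>
      (integrable_const _).add ((hi k).const_mul 2).neg)
  have i3 : Integrable (fun z => ⨆ k, (a k + ((∫ w, ψ k w ∂D) - ψ k z))) D :=
    integrable_iSup_finite (fun k => by have := hψ k; fun_prop) (fun k =>
      (integrable_const _).add ((integrable_const _).sub (hi k)))
  set s := ∫ z, (⨆ k, (a k + 2 * ψ k z)) ∂D with hs
  have h1 : ∀ k, a k + 2 * ∫ w, ψ k w ∂D ≤ s := fun k => by
    have e : ∫ z, (a k + 2 * ψ k z) ∂D = a k + 2 * ∫ w, ψ k w ∂D := by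
      rw [integral_add (integrable_const _) ((hi k).const_mul 2), integral_const_mul]; simp
    rw [← e]
    exact integral_mono ((integrable_const _).add ((hi k).const_mul 2)) i1
      fun z => le_iSup_finite (fun k => a k + 2 * ψ k z) k
  have h2 : ∫ z, (⨆ k, (a k + ((∫ w, ψ k w ∂D) - ψ k z))) ∂D ≤
      ∫ z, (s + ⨆ k, (a k + -(2 * ψ k z))) / 2 ∂D := by
    refine integral_mono i3 (((integrable_const _).add i2).div_const 2) fun z =>
      ciSup_le fun k => ?_
    have := le_iSup_finite (fun k => a k + -(2 * ψ k z)) k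
    have h1k := h1 k
    simp only at this ⊢
    linarith
  refine h2.trans (le_of_eq ?_)
  rw [integral_div, integral_div, integral_add (integrable_const _) i2, integral_add i1 i2]
  simp [hs]

theorem integrable_iSup_add_sum {n : ℕ} {ψ : κ → Z → ℝ} (hψ : ∀ k, Measurable (ψ k))
    (hψ1 : ∀ k z, |ψ k z| ≤ 1) (a b : κ → ℝ) (d : Fin n → ℝ) :
    Integrable (fun S : Fin n → Z => ⨆ k, (a k + ∑ i, (b k + d i * ψ k (S i))))
      (Measure.pi fun _ => D) := by
  have hm : ∀ k i, Measurable fun S : Fin n → Z => ψ k (S i) := fun k i =>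
    (hψ k).comp (measurable_pi_apply i)
  refine integrable_iSup_finite (fun k => ?_) (fun k => ?_)
  · have := hm k; fun_prop
  · refine (integrable_const _).add (integrable_finsetSum _ fun i _ => ?_)
    exact (integrable_const _).add
      ((integrable_of_measurable_of_abs_le (hm k i) fun S => hψ1 k _).const_mul _)

/-- Symmetrization: the expected uniform deviation is at most twice the Rademacher complexity. -/
theorem integral_iSup_le_signAvg [Nonempty κ] {n : ℕ} {ψ : κ → Z → ℝ} (hψ : ∀ k, Measurable (ψ k))
    (hψ1 : ∀ k z, |ψ k z| ≤ 1) (a : κ → ℝ) :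
    ∫ S, (⨆ k, (a k + ∑ i, ((∫ w, ψ k w ∂D) - ψ k (S i)))) ∂(Measure.pi fun _ : Fin n => D) ≤
      ∫ S, signAvg n (fun s => ⨆ k, (a k + ∑ i, s i * (2 * ψ k (S i))))
        ∂(Measure.pi fun _ : Fin n => D) := by
  have I1 : ∀ (n : ℕ) (a : κ → ℝ), Integrable (fun S : Fin n → Z =>
      ⨆ k, (a k + ∑ i, ((∫ w, ψ k w ∂D) - ψ k (S i)))) (Measure.pi fun _ => D) := fun n a => by
    simpa [sub_eq_add_neg] using
      integrable_iSup_add_sum hψ hψ1 a (fun k => ∫ w, ψ k w ∂D) (fun _ : Fin n => -1)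
  have I2 : ∀ (n : ℕ) (a : κ → ℝ), Integrable (fun S : Fin n → Z =>
      signAvg n (fun s => ⨆ k, (a k + ∑ i, s i * (2 * ψ k (S i))))) (Measure.pi fun _ => D) :=
    fun n a => (signAvg_integral _ fun s => by
      simpa [mul_assoc] using
        integrable_iSup_add_sum hψ hψ1 a (fun _ => 0) (fun i : Fin n => s i * 2)).1
  induction n generalizing a with
  | zero => simp [signAvg]
  | succ n ih =>
    set c : κ → ℝ := fun k => ∫ w, ψ k w ∂D with hc
    rw [integral_pi_succ' (I1 (n + 1) a), integral_pi_succ (I2 (n + 1) a)]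
    simp only [Fin.sum_univ_succ, Fin.cons_zero, Fin.cons_succ]
    have hJ : ∀ e : ℝ, Integrable (fun p : Z × (Fin n → Z) =>
        ⨆ k, (a k + ∑ i, (c k - ψ k (p.2 i)) + e * (2 * ψ k p.1)))
        (D.prod (Measure.pi fun _ => D)) := fun e => by
      have hm : ∀ k i, Measurable fun p : Z × (Fin n → Z) => ψ k (p.2 i) := fun k i =>
        (hψ k).comp ((measurable_pi_apply i).comp measurable_snd)
      have hm' : ∀ k, Measurable fun p : Z × (Fin n → Z) => ψ k p.1 := fun k =>
        (hψ k).comp measurable_fst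
      refine integrable_iSup_finite (fun k => ?_) (fun k => ?_)
      · have := hm k; have := hm' k; fun_prop
      · refine ((integrable_const _).add (integrable_finsetSum _ fun i _ => ?_)).add ?_
        · exact (integrable_const _).sub
            (integrable_of_measurable_of_abs_le (hm k i) fun S => hψ1 k _)
        · exact ((integrable_of_measurable_of_abs_le (hm' k) fun S => hψ1 k _).const_mul _).const_mul _
    have hJ2 : Integrable (fun p : Z × (Fin n → Z) =>
        ((⨆ k, (a k + ∑ i, (c k - ψ k (p.2 i)) + 1 * (2 * ψ k p.1))) +
          ⨆ k, (a k + ∑ i, (c k - ψ k (p.2 i)) + -1 * (2 * ψ k p.1))) / 2)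
        (D.prod (Measure.pi fun _ => D)) := ((hJ 1).add (hJ (-1))).div_const 2
    calc _ ≤ ∫ y, ∫ z, ((⨆ k, (a k + ∑ i, (c k - ψ k (y i)) + 1 * (2 * ψ k z))) +
          ⨆ k, (a k + ∑ i, (c k - ψ k (y i)) + -1 * (2 * ψ k z))) / 2 ∂D
            ∂(Measure.pi fun _ : Fin n => D) := by
          refine integral_mono ?_ hJ2.integral_prod_right fun y => ?_
          · have := (integrable_cons (I1 (n + 1) a)).integral_prod_right
            simpa only [Fin.sum_univ_succ, Fin.cons_zero, Fin.cons_succ] using this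
          · have := integral_iSup_symmetrize (D := D) hψ hψ1
              (fun k => a k + ∑ i, (c k - ψ k (y i)))
            simp only [one_mul, neg_one_mul]
            refine le_trans (le_of_eq ?_) this
            congr 1; ext z; congr 1; ext k; ring
      _ = ∫ z, ∫ y, ((⨆ k, (a k + ∑ i, (c k - ψ k (y i)) + 1 * (2 * ψ k z))) +
          ⨆ k, (a k + ∑ i, (c k - ψ k (y i)) + -1 * (2 * ψ k z))) / 2
            ∂(Measure.pi fun _ : Fin n => D) ∂D := (integral_integral_swap hJ2).symm
      _ ≤ _ := by
          have hR := (integrable_cons (I2 (n + 1) a)).integral_prod_left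
          simp only [Fin.sum_univ_succ, Fin.cons_zero, Fin.cons_succ] at hR
          refine integral_mono hJ2.integral_prod_left hR fun z => ?_
          simp only [signAvg, Fin.cons_zero, Fin.cons_succ, ← add_assoc]
          have K : ∀ e : ℝ,
              ∫ y, (⨆ k, (a k + ∑ i, (c k - ψ k (y i)) + e * (2 * ψ k z)))
                ∂(Measure.pi fun _ : Fin n => D) ≤
              ∫ y, signAvg n (fun s => ⨆ k, (a k + e * (2 * ψ k z) +
                ∑ i, s i * (2 * ψ k (y i)))) ∂(Measure.pi fun _ : Fin n => D) := fun e => by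
            simpa only [add_right_comm] using ih (fun k => a k + e * (2 * ψ k z))
          have J : ∀ e : ℝ, Integrable (fun y : Fin n → Z =>
              ⨆ k, (a k + ∑ i, (c k - ψ k (y i)) + e * (2 * ψ k z)))
              (Measure.pi fun _ => D) := fun e => by
            simpa only [add_right_comm] using I1 n (fun k => a k + e * (2 * ψ k z))
          rw [integral_div, integral_div, integral_add (J 1) (J (-1)),
            integral_add (I2 n fun k => a k + 1 * (2 * ψ k z))
              (I2 n fun k => a k + -1 * (2 * ψ k z))]
          have := K 1
          have := K (-1)
          linarith

theorem measure_uniform_deviation_le [Nonempty κ] {n : ℕ} {ψ : κ → Z → ℝ} (hψ : ∀ k, Measurable (ψ k))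
    (hψ0 : ∀ k z, 0 ≤ ψ k z) (hψ1 : ∀ k z, ψ k z ≤ 1) {r u : ℝ} (hu : 0 ≤ u)
    (hr : ∀ S : Fin n → Z, signAvg n (fun s => ⨆ k, ∑ i, s i * ψ k (S i)) ≤ n * r) :
    Measure.pi (fun _ : Fin n => D)
      {S | ∃ k, ∑ i, ψ k (S i) + n * (2 * r + u) < n * ∫ w, ψ k w ∂D} ≤
      ENNReal.ofReal (Real.exp (-2 * n * u ^ 2)) := by
  have hψa : ∀ k z, |ψ k z| ≤ 1 := fun k z => by
    rw [abs_of_nonneg (hψ0 k z)]; exact hψ1 k z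
  set P := Measure.pi (fun _ : Fin n => D)
  set Φ : (Fin n → Z) → ℝ := fun S => ⨆ k, ∑ i, ((∫ w, ψ k w ∂D) - ψ k (S i)) with hΦ
  have hΦm : Measurable Φ := Measurable.iSup fun k => by
    have : ∀ i, Measurable fun S : Fin n → Z => ψ k (S i) := fun i =>
      (hψ k).comp (measurable_pi_apply i)
    fun_prop
  have hc01 : ∀ k, |∫ w, ψ k w ∂D| ≤ 1 := fun k => by
    have := norm_integral_le_of_norm_le_const (μ := D) (f := ψ k)
      (.of_forall fun w => hψa k w)
    simpa using this
  have hΦM : ∀ S, |Φ S| ≤ n * 2 := fun S => by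
    obtain ⟨k, hk⟩ := exists_eq_ciSup_of_finite
      (f := fun k => ∑ i, ((∫ w, ψ k w ∂D) - ψ k (S i)))
    rw [hΦ]
    simp only
    rw [← hk]
    refine (Finset.abs_sum_le_sum_abs _ _).trans ?_
    refine (Finset.sum_le_sum (g := fun _ => (2 : ℝ)) fun i _ => ?_).trans (by simp)
    exact (abs_sub _ _).trans (by linarith [hc01 k, hψa k (S i)])
  have hΦc : ∀ S i z, Φ (Function.update S i z) ≤ Φ S + 1 := fun S i z => by
    refine ciSup_le fun k => ?_
    refine le_trans ?_ (add_le_add_left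
      (le_iSup_finite (fun k => ∑ i, ((∫ w, ψ k w ∂D) - ψ k (S i))) k) 1)
    rw [← Finset.add_sum_erase _ _ (Finset.mem_univ i), ← Finset.add_sum_erase _ (fun j =>
      (∫ w, ψ k w ∂D) - ψ k (S j)) (Finset.mem_univ i), Function.update_self]
    have : ∑ j ∈ Finset.univ.erase i, ((∫ w, ψ k w ∂D) - ψ k (Function.update S i z j)) =
        ∑ j ∈ Finset.univ.erase i, ((∫ w, ψ k w ∂D) - ψ k (S j)) :=
      Finset.sum_congr rfl fun j hj => by rw [Function.update_of_ne (Finset.ne_of_mem_erase hj)]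
    rw [this]
    linarith [hψ0 k z, hψ1 k (S i)]
  have hΦE : ∫ S, Φ S ∂P ≤ n * (2 * r) := by
    have h1 := integral_iSup_le_signAvg (D := D) (n := n) hψ hψa (fun _ => 0)
    simp only [zero_add] at h1
    refine h1.trans ?_
    have h2 : ∀ S : Fin n → Z,
        signAvg n (fun s => ⨆ k, ∑ i, s i * (2 * ψ k (S i))) ≤ n * (2 * r) := fun S => by
      have : ∀ s : Fin n → ℝ, (⨆ k, ∑ i, s i * (2 * ψ k (S i))) =
          2 * ⨆ k, ∑ i, s i * ψ k (S i) := fun s => by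
        rw [Real.mul_iSup_of_nonneg two_pos.le]
        congr 1; ext k; rw [Finset.mul_sum]
        exact Finset.sum_congr rfl fun i _ => by ring
      simp only [this]
      rw [signAvg_const_mul]
      linarith [hr S]
    refine (integral_mono ?_ (integrable_const (n * (2 * r))) h2).trans (by simp)
    refine (signAvg_integral _ fun s => ?_).1
    simpa [mul_assoc] using
      integrable_iSup_add_sum (D := D) hψ hψa (fun _ => 0) (fun _ => 0) (fun i : Fin n => s i * 2)
  have hsub : {S | ∃ k, ∑ i, ψ k (S i) + n * (2 * r + u) < n * ∫ w, ψ k w ∂D} ⊆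
      {S | n * u ≤ Φ S - ∫ S', Φ S' ∂P} := by
    rintro S ⟨k, hk⟩
    have h1 := le_iSup_finite (fun k => ∑ i, ((∫ w, ψ k w ∂D) - ψ k (S i))) k
    simp only [Finset.sum_sub_distrib, Finset.sum_const, Finset.card_univ, Fintype.card_fin,
      nsmul_eq_mul] at h1
    have h2 : Φ S = ⨆ k, (n * (∫ w, ψ k w ∂D) - ∑ i, ψ k (S i)) := by
      simp [hΦ, Finset.sum_sub_distrib]
    simp only [Set.mem_ofPred_eq, h2]
    linarith
  refine (measure_mono hsub).trans ?_
  rw [ENNReal.le_ofReal_iff_toReal_le (measure_ne_top _ _) (Real.exp_pos _).le]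
  have hint : Integrable (fun S => Real.exp (4 * u * (Φ S - ∫ S', Φ S' ∂P))) P := by
    refine integrable_of_measurable_of_abs_le
      (M := Real.exp (4 * u * (n * 2 - ∫ S', Φ S' ∂P))) (by fun_prop) fun S => ?_
    rw [Real.abs_exp, Real.exp_le_exp]
    gcongr
    exact (le_abs_self _).trans (hΦM S)
  -- `4 * u` is the optimal Chernoff parameter: the exponent is `n (2 u² - 4 u²)`.
  have h3 := ProbabilityTheory.measure_ge_le_exp_mul_mgf (μ := P)
    (X := fun S => Φ S - ∫ S', Φ S' ∂P) (n * u) (t := 4 * u) (by positivity) hint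
  refine h3.trans ?_
  have h4 : ProbabilityTheory.mgf (fun S => Φ S - ∫ S', Φ S' ∂P) P (4 * u) ≤
      Real.exp (n * ((4 * u) ^ 2 * 1 ^ 2 / 8)) :=
    integral_exp_le_of_bounded_differences hΦm hΦM hΦc (4 * u)
  refine (mul_le_mul_of_nonneg_left h4 (Real.exp_pos _).le).trans (le_of_eq ?_)
  rw [← Real.exp_add]; congr 1; ring

/-- The failure events of the initial finite subfamilies increase to the full one, and the bound
does not depend on their size, so continuity from below applies. -/
theorem measure_uniform_deviation_nat_le {n : ℕ} {ψ : ℕ → Z → ℝ} (hψ : ∀ k, Measurable (ψ k))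
    (hψ0 : ∀ k z, 0 ≤ ψ k z) (hψ1 : ∀ k z, ψ k z ≤ 1) {r u : ℝ} (hu : 0 ≤ u)
    (hr : ∀ (N : ℕ) (S : Fin n → Z),
      signAvg n (fun s => ⨆ k : Set.Iic N, ∑ i, s i * ψ k (S i)) ≤ n * r) :
    Measure.pi (fun _ : Fin n => D)
      {S | ∃ k, ∑ i, ψ k (S i) + n * (2 * r + u) < n * ∫ w, ψ k w ∂D} ≤
      ENNReal.ofReal (Real.exp (-2 * n * u ^ 2)) := by
  have e : {S : Fin n → Z | ∃ k, ∑ i, ψ k (S i) + n * (2 * r + u) < n * ∫ w, ψ k w ∂D} =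
      ⋃ k, {S : Fin n → Z | ∑ i, ψ k (S i) + n * (2 * r + u) < n * ∫ w, ψ k w ∂D} := by
    ext S; simp
  rw [e, measure_iUnion_eq_iSup_accumulate]
  refine iSup_le fun N => ?_
  refine le_trans (measure_mono ?_) (measure_uniform_deviation_le (D := D)
    (ψ := fun k : Set.Iic N => ψ k) (fun k => hψ k) (fun k => hψ0 k) (fun k => hψ1 k) hu (hr N))
  intro S hS
  obtain ⟨k, hk, h⟩ := Set.mem_accumulate.1 hS
  exact ⟨⟨k, hk⟩, h⟩

end Concentration

end AlgSel

end

/-! ### The ramp loss on normalised inputs. -/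

noncomputable section

namespace AlgSel

/-- The ramp function: `1` on `(-∞, 0]`, `0` on `[1, ∞)` and linear in between. -/
def ramp (t : ℝ) : ℝ := max 0 (min 1 (1 - t))

theorem ramp_nonneg (t : ℝ) : 0 ≤ ramp t := le_max_left _ _

theorem ramp_le_one (t : ℝ) : ramp t ≤ 1 := max_le zero_le_one (min_le_left _ _)

theorem ramp_of_nonpos {t : ℝ} (ht : t ≤ 0) : ramp t = 1 := by
  rw [ramp, min_eq_left (by linarith), max_eq_right zero_le_one]

theorem ramp_of_one_le {t : ℝ} (ht : 1 ≤ t) : ramp t = 0 := by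
  rw [ramp, min_eq_right (by linarith), max_eq_left (by linarith)]

theorem continuous_ramp : Continuous ramp := by unfold ramp; fun_prop

theorem abs_ramp_sub_ramp_le (a b : ℝ) : |ramp a - ramp b| ≤ |a - b| := by
  unfold ramp
  rw [max_comm 0, max_comm 0, min_comm 1, min_comm 1]
  refine (abs_max_sub_max_le_abs _ _ (0 : ℝ)).trans ?_
  refine (abs_inf_sub_inf_le_abs (1 - a) (1 - b) (1 : ℝ)).trans (le_of_eq ?_)
  rw [abs_sub_comm]; congr 1; ring

variable {dP dA : ℕ}

/-- The input of an instance, scaled to the unit sphere (or zero). -/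
def unitInput (z : LabeledInstance dP dA) : EuclideanSpace ℝ (Fin dP ⊕ Fin dA) :=
  ‖input z‖⁻¹ • input z

/-- The label of an instance, clamped to `[-1, 1]`. -/
def clampedLabel (z : LabeledInstance dP dA) : ℝ := max (-1) (min 1 (label z))

/-- The ramp loss of `f` on the scaled input, at margin `ρ`. -/
def rampLoss (ρ : ℝ) (f : EuclideanSpace ℝ (Fin dP ⊕ Fin dA) → ℝ)
    (z : LabeledInstance dP dA) : ℝ :=
  ramp (clampedLabel z * (f (unitInput z) / ρ))

theorem norm_unitInput_le (z : LabeledInstance dP dA) : ‖unitInput z‖ ≤ 1 := by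
  rw [unitInput, norm_smul, norm_inv, norm_norm]
  exact inv_mul_le_one

theorem abs_clampedLabel_le (z : LabeledInstance dP dA) : |clampedLabel z| ≤ 1 :=
  abs_le.2 ⟨le_max_left _ _, max_le (by norm_num) (min_le_left _ _)⟩

theorem clampedLabel_eq {z : LabeledInstance dP dA} (h : label z = 1 ∨ label z = -1) :
    clampedLabel z = label z := by
  rcases h with h | h <;> simp [clampedLabel, h]

theorem measurable_input : Measurable (input : LabeledInstance dP dA → _) := by
  refine (WithLp.measurable_toLp 2 _).comp (measurable_pi_iff.2 fun i => ?_)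
  cases i with
  | inl i => simp only [Sum.elim_inl]; fun_prop
  | inr i => simp only [Sum.elim_inr]; fun_prop

theorem measurable_label : Measurable (label : LabeledInstance dP dA → ℝ) :=
  measurable_snd.comp measurable_snd

theorem measurable_unitInput : Measurable (unitInput : LabeledInstance dP dA → _) :=
  measurable_input.norm.inv.smul measurable_input

theorem measurable_rampLoss (ρ : ℝ) {f : EuclideanSpace ℝ (Fin dP ⊕ Fin dA) → ℝ}
    (hf : Continuous f) : Measurable (rampLoss ρ f) :=
  continuous_ramp.measurable.comp ((measurable_const.max (measurable_const.min measurable_label)).mul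
    ((hf.measurable.comp measurable_unitInput).div_const ρ))

/-! ### Uniform deviation of the ramp loss, over networks and over dyadic margins. -/

section Deviation

variable {l : ℕ} {R : ℕ → ℝ} {n : ℕ}

/-- The ramp is 1-Lipschitz and clamped labels have absolute value at most one, so contraction
reduces the loss class to the networks scaled by `1 / ρ`. -/
theorem signAvg_iSup_rampLoss_le (hl : 1 ≤ l) (hR : ∀ i ∈ Finset.Icc 1 l, 0 < R i) (hn : 1 ≤ n)
    (hnl : Real.log 2 * l ≤ √n) {κ : Type} [Finite κ] [Nonempty κ]
    (f : κ → EuclideanSpace ℝ (Fin dP ⊕ Fin dA) → ℝ)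
    (hf : ∀ k, f k ∈ networkClass (Fin dP ⊕ Fin dA) l R) {ρ : ℝ} (hρ : 0 < ρ)
    (S : Fin n → LabeledInstance dP dA) :
    signAvg n (fun s => ⨆ k, ∑ i, s i * rampLoss ρ (f k) (S i)) ≤
      n * (4 * (gammaF l R / ρ) / (n : ℝ) ^ (1 / 4 : ℝ)) := by
  have h1 := signAvg_contraction (fun _ : κ => (0 : ℝ))
    (fun k (i : Fin n) => f k (unitInput (S i)) / ρ) (fun k i => rampLoss ρ (f k) (S i))
    (fun k k' i => by
      refine (abs_ramp_sub_ramp_le _ _).trans ?_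
      rw [← mul_sub, abs_mul]
      exact mul_le_of_le_one_left (abs_nonneg _) (abs_clampedLabel_le _))
  simp only [zero_add] at h1
  refine h1.trans ?_
  have h2 : ∀ s : Fin n → ℝ, (⨆ k, ∑ i, s i * (f k (unitInput (S i)) / ρ)) =
      ρ⁻¹ * ⨆ k, ∑ i, s i * f k (unitInput (S i)) := fun s => by
    rw [Real.mul_iSup_of_nonneg (by positivity)]
    congr 1; ext k; rw [Finset.mul_sum]
    exact Finset.sum_congr rfl fun i _ => by ring
  simp only [h2]
  rw [signAvg_const_mul]
  have h3 := signAvg_iSup_networkClass_le hl hR hn hnl (fun i => unitInput (S i))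
    (fun i => norm_unitInput_le _) f hf
  refine (mul_le_mul_of_nonneg_left h3 (by positivity)).trans (le_of_eq ?_)
  ring

/-- The class is separable in the compact-open topology, so the countable bound applies to a dense
sequence. Pointwise limits and dominated convergence extend the inequality to every network. -/
theorem measure_rampLoss_deviation_le (D : Measure (LabeledInstance dP dA))
    [IsProbabilityMeasure D] (hl : 1 ≤ l)
    (hR : ∀ i ∈ Finset.Icc 1 l, 0 < R i) (hn : 1 ≤ n) (hnl : Real.log 2 * l ≤ √n) {ρ u : ℝ}
    (hρ : 0 < ρ) (hu : 0 ≤ u) :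
    Measure.pi (fun _ : Fin n => D)
      {S | ∃ f ∈ networkClass (Fin dP ⊕ Fin dA) l R, ∑ i, rampLoss ρ f (S i) +
        n * (2 * (4 * (gammaF l R / ρ) / (n : ℝ) ^ (1 / 4 : ℝ)) + u) <
          n * ∫ z, rampLoss ρ f z ∂D} ≤
      ENNReal.ofReal (Real.exp (-2 * n * u ^ 2)) := by
  set C : Set C(EuclideanSpace ℝ (Fin dP ⊕ Fin dA), ℝ) :=
    {g | ⇑g ∈ networkClass (Fin dP ⊕ Fin dA) l R}
  rcases isEmpty_or_nonempty C with hC | hC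
  · refine le_trans (le_of_eq ?_) zero_le
    convert! measure_empty (μ := Measure.pi fun _ : Fin n => D)
    refine Set.eq_empty_of_forall_notMem ?_
    rintro S ⟨f, hf, -⟩
    exact hC.elim ⟨⟨f, continuous_of_mem_networkClass hl hR hf⟩, hf⟩
  set q := TopologicalSpace.denseSeq C
  refine le_trans (measure_mono ?_) (measure_uniform_deviation_nat_le (D := D)
    (ψ := fun k => rampLoss ρ (q k).1) (fun k => measurable_rampLoss ρ (q k).1.continuous)
    (fun k z => ramp_nonneg _) (fun k z => ramp_le_one _) hu
    (fun N S => signAvg_iSup_rampLoss_le hl hR hn hnl (fun k : Set.Iic N => ⇑(q k).1)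
      (fun k => (q k).2) hρ S))
  rintro S ⟨f, hf, hS⟩
  by_contra hcon
  have hall : ∀ k, n * ∫ z, rampLoss ρ (q k).1 z ∂D ≤ ∑ i, rampLoss ρ (q k).1 (S i) +
      n * (2 * (4 * (gammaF l R / ρ) / (n : ℝ) ^ (1 / 4 : ℝ)) + u) := fun k => by
    by_contra h
    exact hcon ⟨k, not_le.1 h⟩
  set g : C := ⟨⟨f, continuous_of_mem_networkClass hl hR hf⟩, hf⟩
  obtain ⟨v, hv, hlim⟩ := mem_closure_iff_seq_limit.1
    (TopologicalSpace.denseRange_denseSeq C g)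
  have hpt : ∀ x, Filter.Tendsto (fun m => (v m).1 x) Filter.atTop (nhds (f x)) := fun x =>
    ((continuous_eval_const x).comp continuous_subtype_val).continuousAt.tendsto.comp
      hlim
  have hloss : ∀ z, Filter.Tendsto (fun m => rampLoss ρ (v m).1 z) Filter.atTop
      (nhds (rampLoss ρ f z)) := fun z =>
    (continuous_ramp.tendsto _).comp (((hpt _).div_const ρ).const_mul _)
  have hint : Filter.Tendsto (fun m => ∫ z, rampLoss ρ (v m).1 z ∂D) Filter.atTop
      (nhds (∫ z, rampLoss ρ f z ∂D)) := by
    refine tendsto_integral_of_dominated_convergence (fun _ => 1)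
      (fun m => (measurable_rampLoss ρ (v m).1.continuous).aestronglyMeasurable)
      (integrable_const _) (fun m => .of_forall fun z => ?_) (.of_forall hloss)
    rw [Real.norm_eq_abs, rampLoss, abs_of_nonneg (ramp_nonneg _)]
    exact ramp_le_one _
  refine absurd hS (not_lt.2 (le_of_tendsto_of_tendsto' (hint.const_mul _)
    ((tendsto_finsetSum _ fun i _ => hloss (S i)).add_const _) fun m => ?_))
  obtain ⟨k, hk⟩ := hv m
  rw [← hk]
  exact hall k

/-- The half-width of the deviation at the margin `Γ_f / 2 ^ j`. -/
def deviationWidth (n : ℕ) (δ : ℝ) (j : ℕ) : ℝ :=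
  2 ^ j / (n : ℝ) ^ (1 / 4 : ℝ) + √(Real.log (1 / δ) / n)

/-- The first summand of the width satisfies `n (2^j / n^(1/4))² ≥ 2^j`, which pays for the
geometric weight of the union bound. The second pays for `δ`. -/
theorem exp_deviationWidth_le (hn : 1 ≤ n) {δ : ℝ} (hδ : 0 < δ) (hδ1 : δ < 1) (j : ℕ) :
    Real.exp (-2 * n * deviationWidth n δ j ^ 2) ≤ δ / 2 / 2 ^ j := by
  have hn0 : (1 : ℝ) ≤ n := by exact_mod_cast hn
  have hL : 0 < Real.log (1 / δ) := Real.log_pos (by rw [lt_div_iff₀ hδ]; linarith)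
  set q : ℝ := (n : ℝ) ^ (1 / 4 : ℝ) with hq
  have hq1 : 1 ≤ q := Real.one_le_rpow hn0 (by norm_num)
  have hq4 : q ^ 4 = n := by
    rw [hq, ← Real.rpow_natCast, ← Real.rpow_mul (by linarith)]; norm_num
  have h1 : (2 : ℝ) ^ j ≤ n * (2 ^ j / q) ^ 2 := by
    have h2 : (1 : ℝ) ≤ 2 ^ j := one_le_pow₀ (by norm_num)
    have e : n * ((2 : ℝ) ^ j / q) ^ 2 = 2 ^ j * (2 ^ j * q ^ 2) := by
      rw [← hq4]; field_simp
    rw [e]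
    exact le_mul_of_one_le_right (by positivity)
      (one_le_mul_of_one_le_of_one_le h2 (one_le_pow₀ hq1))
  have h2 : n * √(Real.log (1 / δ) / n) ^ 2 = Real.log (1 / δ) := by
    rw [Real.sq_sqrt (by positivity)]; field_simp
  have h3 : 2 ^ j + Real.log (1 / δ) ≤ n * deviationWidth n δ j ^ 2 := by
    rw [deviationWidth, add_sq]
    have : 0 ≤ n * (2 * (2 ^ j / q) * √(Real.log (1 / δ) / n)) := by positivity
    nlinarith
  have h4 : Real.exp (-2 * n * deviationWidth n δ j ^ 2) ≤
      Real.exp (-(2 * 2 ^ j)) * Real.exp (-Real.log (1 / δ)) := by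
    rw [← Real.exp_add]
    exact Real.exp_le_exp.2 (by nlinarith)
  refine h4.trans ?_
  rw [Real.exp_neg (Real.log _), Real.exp_log (by positivity), one_div, inv_inv, Real.exp_neg]
  have h5 : 2 * 2 ^ j ≤ Real.exp (2 * 2 ^ j) := by
    linarith [Real.add_one_le_exp ((2 : ℝ) * 2 ^ j)]
  rw [div_div, div_eq_inv_mul]
  gcongr

theorem measure_rampLoss_deviation_all_le (D : Measure (LabeledInstance dP dA))
    [IsProbabilityMeasure D] (hl : 1 ≤ l)
    (hR : ∀ i ∈ Finset.Icc 1 l, 0 < R i) (hn : 1 ≤ n) (hnl : Real.log 2 * l ≤ √n) {δ : ℝ}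
    (hδ : 0 < δ) (hδ1 : δ < 1) :
    Measure.pi (fun _ : Fin n => D)
      {S | ∃ j : ℕ, ∃ f ∈ networkClass (Fin dP ⊕ Fin dA) l R,
        ∑ i, rampLoss (gammaF l R / 2 ^ j) f (S i) +
          n * (8 * 2 ^ j / (n : ℝ) ^ (1 / 4 : ℝ) + deviationWidth n δ j) <
            n * ∫ z, rampLoss (gammaF l R / 2 ^ j) f z ∂D} ≤ ENNReal.ofReal δ := by
  have hΓ : 0 < gammaF l R := Finset.prod_pos hR
  have hs := hasSum_geometric_two' δ
  have hsum : ENNReal.ofReal δ = ∑' j : ℕ, ENNReal.ofReal (δ / 2 / 2 ^ j) := by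
    rw [← ENNReal.ofReal_tsum_of_nonneg (fun j => by positivity) hs.summable, hs.tsum_eq]
  rw [hsum]
  have e : ∀ P : ℕ → (Fin n → LabeledInstance dP dA) → Prop,
      {S | ∃ j, P j S} = ⋃ j, {S | P j S} := fun P => by ext S; simp
  rw [e]
  refine (measure_iUnion_le _).trans (ENNReal.tsum_le_tsum fun j => ?_)
  have h := measure_rampLoss_deviation_le D hl hR hn hnl (ρ := gammaF l R / 2 ^ j)
    (u := deviationWidth n δ j) (by positivity) (by unfold deviationWidth; positivity)
  rw [div_div_cancel₀ hΓ.ne', ← mul_div_assoc, ← mul_assoc, show (2 : ℝ) * 4 = 8 by norm_num] at h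
  exact h.trans (ENNReal.ofReal_le_ofReal (exp_deviationWidth_le hn hδ hδ1 j))

end Deviation

/-! ### From the ramp loss to test and empirical errors. -/

section Errors

variable {l : ℕ} {R : ℕ → ℝ} {f : EuclideanSpace ℝ (Fin dP ⊕ Fin dA) → ℝ}

theorem apply_unitInput (hl : 1 ≤ l) (hR : ∀ i ∈ Finset.Icc 1 l, 0 < R i)
    (hf : f ∈ networkClass (Fin dP ⊕ Fin dA) l R) (z : LabeledInstance dP dA) :
    f (unitInput z) = ‖input z‖⁻¹ * f (input z) :=
  map_smul_of_mem_networkClass hl hR hf (by positivity) _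

theorem testError_le_integral_rampLoss (D : Measure (LabeledInstance dP dA))
    [IsProbabilityMeasure D] (hD : ∀ᵐ z ∂D, label z = 1 ∨ label z = -1) (hl : 1 ≤ l)
    (hR : ∀ i ∈ Finset.Icc 1 l, 0 < R i) (hf : f ∈ networkClass (Fin dP ⊕ Fin dA) l R)
    {ρ : ℝ} (hρ : 0 < ρ) : testError D f ≤ ∫ z, rampLoss ρ f z ∂D := by
  have hcont := continuous_of_mem_networkClass hl hR hf
  have hms : MeasurableSet {z : LabeledInstance dP dA | label z * f (input z) < 0} :=
    measurableSet_lt (measurable_label.mul (hcont.measurable.comp measurable_input))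
      measurable_const
  rw [testError, ← integral_indicator_one hms]
  refine integral_mono_ae ((integrable_const (1 : ℝ)).indicator hms)
    (integrable_of_measurable_of_abs_le (M := 1) (measurable_rampLoss ρ hcont) fun z => ?_) ?_
  · rw [rampLoss, abs_of_nonneg (ramp_nonneg _)]; exact ramp_le_one _
  · filter_upwards [hD] with z hz
    rcases lt_or_ge (label z * f (input z)) 0 with hz0 | hz0
    swap
    · rw [Set.indicator_of_notMem (show z ∉ {z | label z * f (input z) < 0} from not_lt.2 hz0)]
      exact ramp_nonneg _
    rw [Set.indicator_of_mem (show z ∈ {z | label z * f (input z) < 0} from hz0), Pi.one_apply]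
    refine (ramp_of_nonpos ?_).ge
    rw [clampedLabel_eq hz, apply_unitInput hl hR hf]
    have e : label z * (‖input z‖⁻¹ * f (input z) / ρ) =
        (label z * f (input z)) * (‖input z‖⁻¹ / ρ) := by ring
    rw [e]
    exact mul_nonpos_of_nonpos_of_nonneg hz0.le (by positivity)

theorem rampLoss_eq_zero (hl : 1 ≤ l) (hR : ∀ i ∈ Finset.Icc 1 l, 0 < R i)
    (hf : f ∈ networkClass (Fin dP ⊕ Fin dA) l R) {z : LabeledInstance dP dA}
    (hz : label z = 1 ∨ label z = -1) {ρ γ B : ℝ} (hρ : 0 < ρ) (hB : 0 < B) (hργ : ρ * B ≤ γ)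
    (hzB : ‖input z‖ ≤ B) (h : γ ≤ label z * f (input z)) : rampLoss ρ f z = 0 := by
  have hγ : 0 < γ := lt_of_lt_of_le (by positivity) hργ
  -- A zero input gives output zero, which cannot reach the positive margin `γ`.
  have hx : 0 < ‖input z‖ := by
    rw [norm_pos_iff]
    intro h0
    have := abs_le_of_mem_networkClass hl hR hf (input z)
    rw [h0, norm_zero, mul_zero] at this
    rw [h0, abs_nonpos_iff.1 this, mul_zero] at h
    linarith
  apply ramp_of_one_le
  rw [clampedLabel_eq hz, apply_unitInput hl hR hf]
  have e : label z * (‖input z‖⁻¹ * f (input z) / ρ) =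
      (label z * f (input z)) / (ρ * ‖input z‖) := by field_simp
  rw [e, le_div_iff₀ (by positivity), one_mul]
  exact le_trans (by gcongr) (hργ.trans h)

variable {nP nA : ℕ}

theorem norm_input_le_sqrt_gammaS (S : Fin nP × Fin nA → LabeledInstance dP dA) (i) :
    ‖input (S i)‖ ≤ √(gammaS S) :=
  Real.le_sqrt_of_sq_le (le_iSup_finite (fun i => ‖input (S i)‖ ^ 2) i)

theorem sum_rampLoss_le (hP : 1 ≤ nP) (hA : 1 ≤ nA) (hl : 1 ≤ l)
    (hR : ∀ i ∈ Finset.Icc 1 l, 0 < R i) (hf : f ∈ networkClass (Fin dP ⊕ Fin dA) l R)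
    {S : Fin nP × Fin nA → LabeledInstance dP dA}
    (hS : ∀ i, label (S i) = 1 ∨ label (S i) = -1) (hS1 : 1 < gammaS S) {ρ γ : ℝ} (hρ : 0 < ρ)
    (hργ : ρ * √(gammaS S) ≤ γ) :
    ∑ i, rampLoss ρ f (S i) ≤ (nP * nA : ℕ) * empiricalError S γ f := by
  classical
  have hP0 : (nP : ℝ) ≠ 0 := by positivity
  have hA0 : (nA : ℝ) ≠ 0 := by positivity
  rw [empiricalError, Set.ncard_eq_toFinset_card']
  push_cast
  rw [mul_div_cancel₀ _ (mul_ne_zero hP0 hA0), Finset.card_eq_sum_ones, Nat.cast_sum,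
    Set.toFinset_ofPred, Finset.sum_filter]
  refine Finset.sum_le_sum fun i _ => ?_
  split_ifs with h
  · simpa [rampLoss] using ramp_le_one _
  · exact (rampLoss_eq_zero hl hR hf (hS i) hρ (Real.sqrt_pos.2 (by linarith)) hργ
      (norm_input_le_sqrt_gammaS S i) (not_lt.1 h)).le

theorem empiricalError_eq_one (hP : 1 ≤ nP) (hA : 1 ≤ nA) (hl : 1 ≤ l)
    (hR : ∀ i ∈ Finset.Icc 1 l, 0 < R i) (hf : f ∈ networkClass (Fin dP ⊕ Fin dA) l R)
    {S : Fin nP × Fin nA → LabeledInstance dP dA}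
    (hS : ∀ i, label (S i) = 1 ∨ label (S i) = -1) {γ : ℝ}
    (hγ : gammaF l R * √(gammaS S) < γ) : empiricalError S γ f = 1 := by
  have hP0 : (nP : ℝ) ≠ 0 := by positivity
  have hA0 : (nA : ℝ) ≠ 0 := by positivity
  have hΓ : 0 < gammaF l R := Finset.prod_pos hR
  have : {i | label (S i) * f (input (S i)) < γ} = Set.univ := by
    refine Set.eq_univ_of_forall fun i => ?_
    refine lt_of_le_of_lt ?_ hγ
    calc label (S i) * f (input (S i)) ≤ |label (S i)| * |f (input (S i))| := by
          rw [← abs_mul]; exact le_abs_self _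
      _ = |f (input (S i))| := by rcases hS i with h | h <;> simp [h]
      _ ≤ gammaF l R * ‖input (S i)‖ := abs_le_of_mem_networkClass hl hR hf _
      _ ≤ _ := by gcongr; exact norm_input_le_sqrt_gammaS S i
  rw [empiricalError, this, Set.ncard_univ]
  simp [hP0, hA0]

theorem sqrt_div_le_c₁_div {δ : ℝ} (γ : ℝ) {N : ℝ} (hN : 0 ≤ N) :
    √(Real.log (1 / δ) / N) ≤ c₁ γ δ / √N := by
  rw [Real.sqrt_div' _ hN, c₁]
  gcongr
  linarith [Real.sqrt_nonneg (Real.log (max 1 (Real.logb 2 (4 / γ))))]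

theorem testError_le_of_deviation (D : Measure (LabeledInstance dP dA))
    [IsProbabilityMeasure D] (hD : ∀ᵐ z ∂D, label z = 1 ∨ label z = -1) (hP : 1 ≤ nP)
    (hA : 1 ≤ nA) (hl : 1 ≤ l) (hR : ∀ i ∈ Finset.Icc 1 l, 0 < R i) {δ : ℝ}
    {S : Fin nP × Fin nA → LabeledInstance dP dA}
    (hS : ∀ i, label (S i) = 1 ∨ label (S i) = -1) (hS1 : 1 < gammaS S)
    (hf : f ∈ networkClass (Fin dP ⊕ Fin dA) l R)
    (hdev : ∀ j : ℕ, (nP * nA : ℕ) * ∫ z, rampLoss (gammaF l R / 2 ^ j) f z ∂D ≤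
      ∑ i, rampLoss (gammaF l R / 2 ^ j) f (S i) + (nP * nA : ℕ) *
        (8 * 2 ^ j / ((nP * nA : ℕ) : ℝ) ^ (1 / 4 : ℝ) + deviationWidth (nP * nA) δ j))
    {γ : ℝ} (hγ : 0 < γ) :
    testError D f ≤ empiricalError S γ f
      + 18 * (gammaF l R * gammaS S ^ (3 / 4 : ℝ)
          / ((nP : ℝ) ^ (1 / 4 : ℝ) * (nA : ℝ) ^ (1 / 4 : ℝ) * γ))
      + 1 * (c₁ γ δ / √((nP : ℝ) * (nA : ℝ))) := by
  have hΓ : 0 < gammaF l R := Finset.prod_pos hR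
  have hP0 : (0 : ℝ) < nP := by exact_mod_cast hP
  have hA0 : (0 : ℝ) < nA := by exact_mod_cast hA
  have hc : 0 ≤ c₁ γ δ := add_nonneg (Real.sqrt_nonneg _) (Real.sqrt_nonneg _)
  have hG : 0 < gammaS S := by linarith
  set B := √(gammaS S) with hB
  have hB0 : 0 < B := Real.sqrt_pos.2 hG
  -- If `γ` exceeds every possible output on the sample, the empirical error is 1 and the bound is
  -- trivial. Otherwise the ratio below is at least 1 and a dyadic index exists.
  rcases lt_or_ge (gammaF l R * B) γ with h | h
  · rw [empiricalError_eq_one hP hA hl hR hf hS h]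
    have h1 : testError D f ≤ 1 := measureReal_le_one
    have h2 : 0 ≤ 18 * (gammaF l R * gammaS S ^ (3 / 4 : ℝ)
          / ((nP : ℝ) ^ (1 / 4 : ℝ) * (nA : ℝ) ^ (1 / 4 : ℝ) * γ)) := by positivity
    have h3 : 0 ≤ 1 * (c₁ γ δ / √((nP : ℝ) * (nA : ℝ))) := by positivity
    linarith
  have hx : 1 ≤ gammaF l R * B / γ := by rwa [le_div_iff₀ hγ, one_mul]
  -- The index used is `j + 1`: the upper bound on the ratio gives `ρ B ≤ γ`, and the lower bound
  -- keeps `2^(j+1)` within a factor 2 of it.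
  obtain ⟨j, hj1, hj2⟩ := exists_nat_pow_near hx one_lt_two
  have hN : (((nP * nA : ℕ) : ℝ)) = (nP : ℝ) * nA := by push_cast; rfl
  have hN0 : (0 : ℝ) < ((nP * nA : ℕ) : ℝ) := by rw [hN]; positivity
  have hρ : 0 < gammaF l R / 2 ^ (j + 1) := by positivity
  have hργ : gammaF l R / 2 ^ (j + 1) * B ≤ γ := by
    rw [div_mul_eq_mul_div, div_le_iff₀ (by positivity)]
    rw [div_lt_iff₀ hγ] at hj2
    linarith
  have h1 := testError_le_integral_rampLoss D hD hl hR hf hρ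
  have h2 := hdev (j + 1)
  have h3 := sum_rampLoss_le hP hA hl hR hf hS hS1 hρ hργ
  have h4 : testError D f ≤ empiricalError S γ f +
      (8 * 2 ^ (j + 1) / ((nP * nA : ℕ) : ℝ) ^ (1 / 4 : ℝ) +
        deviationWidth (nP * nA) δ (j + 1)) := by
    refine h1.trans (le_of_mul_le_mul_left ?_ hN0)
    rw [mul_add]
    linarith
  have h5 := sqrt_div_le_c₁_div (δ := δ) γ (mul_pos hP0 hA0).le
  -- The argument produces `√Γ_S`, and `Γ_S > 1` allows the larger exponent.
  have hBG : B ≤ gammaS S ^ (3 / 4 : ℝ) := by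
    rw [hB, Real.sqrt_eq_rpow]
    exact Real.rpow_le_rpow_of_exponent_le hS1.le (by norm_num)
  set Q := ((nP * nA : ℕ) : ℝ) ^ (1 / 4 : ℝ) with hQ
  have hQ' : Q = (nP : ℝ) ^ (1 / 4 : ℝ) * (nA : ℝ) ^ (1 / 4 : ℝ) := by
    rw [hQ, hN, Real.mul_rpow hP0.le hA0.le]
  have hQ0 : 0 < Q := by positivity
  -- The 9 is 8 from the complexity plus 1 from the deviation width. The dyadic rounding doubles it
  -- to 18.
  have h6 : 9 * 2 ^ (j + 1) / Q ≤ 18 * (gammaF l R * gammaS S ^ (3 / 4 : ℝ) / (Q * γ)) := by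
    calc 9 * 2 ^ (j + 1) / Q = 18 * (2 ^ j / Q) := by rw [pow_succ]; ring
      _ ≤ 18 * (gammaF l R * B / γ / Q) := by gcongr
      _ ≤ 18 * (gammaF l R * gammaS S ^ (3 / 4 : ℝ) / γ / Q) := by gcongr
      _ = _ := by rw [div_div, mul_comm γ]
  have h7 : 8 * 2 ^ (j + 1) / Q + deviationWidth (nP * nA) δ (j + 1) =
      9 * 2 ^ (j + 1) / Q + √(Real.log (1 / δ) / ((nP : ℝ) * nA)) := by
    rw [deviationWidth, ← hQ, hN]; ring
  rw [← hQ']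
  linarith

end Errors

theorem pos_of_mem_networkClass {ι : Type} [Fintype ι] {l : ℕ} {R : ℕ → ℝ}
    (hΓ : 1 < gammaF l R) {f : EuclideanSpace ℝ ι → ℝ} (hf : f ∈ networkClass ι l R) :
    ∀ i ∈ Finset.Icc 1 l, 0 < R i := by
  obtain ⟨N, hN, -⟩ := hf
  intro i hi
  refine (hN.nonneg i hi).lt_of_ne' fun h0 => ?_
  have : gammaF l R = 0 := Finset.prod_eq_zero hi h0
  linarith

end AlgSel

end

/-! ### The generalization bound. -/

theorem mainTheorem7 :
    ∃ K₁ K₂ : ℝ, 0 < K₁ ∧ 0 < K₂ ∧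
      ∀ (dP dA nP nA l : ℕ) (R : ℕ → ℝ) (D : Measure (AlgSel.LabeledInstance dP dA)) (δ : ℝ),
        1 ≤ nP → 1 ≤ nA → 1 ≤ l → 0 < δ → δ < 1 →
        IsProbabilityMeasure D →
        (∀ᵐ z ∂D, AlgSel.label z = 1 ∨ AlgSel.label z = -1) →
        1 < AlgSel.gammaF l R →
        Real.log 2 * (l : ℝ) ≤ √((nP : ℝ) * (nA : ℝ)) →
        -- the training sample is i.i.d. with law `D`; the failure event has probability at most `δ`
        Measure.pi (fun _ : Fin nP × Fin nA => D)
          {S | ¬ (1 < AlgSel.gammaS S →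
            ∀ γ : ℝ, 0 < γ → ∀ f ∈ AlgSel.networkClass (Fin dP ⊕ Fin dA) l R,
              AlgSel.testError D f ≤ AlgSel.empiricalError S γ f
                + K₁ * (AlgSel.gammaF l R * AlgSel.gammaS S ^ (3 / 4 : ℝ)
                    / ((nP : ℝ) ^ (1 / 4 : ℝ) * (nA : ℝ) ^ (1 / 4 : ℝ) * γ))
                + K₂ * (AlgSel.c₁ γ δ / √((nP : ℝ) * (nA : ℝ))))} ≤ ENNReal.ofReal δ := by
  refine ⟨18, 1, by norm_num, one_pos, ?_⟩
  intro dP dA nP nA l R D δ hP hA hl hδ hδ1 hDp hD hΓ hnl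
  -- The radii are not assumed positive. A member of the class makes them nonnegative, and `Γ_f > 1`
  -- then excludes zero.
  rcases Set.eq_empty_or_nonempty (AlgSel.networkClass (Fin dP ⊕ Fin dA) l R) with hF | ⟨f₀, hf₀⟩
  · simp [hF]
  have hR := AlgSel.pos_of_mem_networkClass hΓ hf₀
  have hn : 1 ≤ nP * nA := Nat.mul_pos hP hA
  have hmain := AlgSel.measure_rampLoss_deviation_all_le D hl hR hn
    (by push_cast; exact hnl) hδ hδ1
  have hmp := measurePreserving_piCongrLeft (fun _ : Fin (nP * nA) => D) finProdFinEquiv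
  -- A measurable equivalence preserves the measure of arbitrary sets, so the failure event need not
  -- be measurable.
  rw [← hmp.measure_preimage_equiv] at hmain
  refine le_trans (measure_mono_ae ?_) hmain
  have hlab : ∀ᵐ S ∂Measure.pi (fun _ : Fin nP × Fin nA => D),
      ∀ i, AlgSel.label (S i) = 1 ∨ AlgSel.label (S i) = -1 :=
    ae_all_iff.2 fun i => (measurePreserving_eval (fun _ => D) i).quasiMeasurePreserving.ae hD
  filter_upwards [hlab] with S hS hbad
  by_contra hgood
  refine hbad fun hS1 γ hγ f hf =>
    AlgSel.testError_le_of_deviation D hD hP hA hl hR hS hS1 hf (fun j => ?_) hγ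
  by_contra hj
  refine hgood ⟨j, f, hf, ?_⟩
  have e : ∑ i, AlgSel.rampLoss (AlgSel.gammaF l R / 2 ^ j) f
      (MeasurableEquiv.piCongrLeft (fun _ => AlgSel.LabeledInstance dP dA) finProdFinEquiv S i) =
      ∑ i, AlgSel.rampLoss (AlgSel.gammaF l R / 2 ^ j) f (S i) := by
    rw [← finProdFinEquiv.sum_comp]
    refine Finset.sum_congr rfl fun i _ => ?_
    rw [MeasurableEquiv.coe_piCongrLeft, Equiv.piCongrLeft_apply_apply]
  rw [e]
  exact not_le.1 hj
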